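/- **Setting.** Let $\mathcal P$ be the set of primes, let $\mathbb Z_p$ be the ring of $p$-adic integers, and let $\widehat{\mathbb Z}=\prod_{p\in\mathcal P}\mathbb Z_p$ be the ring of integer adeles (profinite integers) with its Haar probability measure $\widehat\mu=\prod_p\mu_p$, where $\mu_p$ is the Haar probability measure on $\mathbb Z_p$. For $x=(x_p)_{p\in\mathcal P}\in\widehat{\mathbb Z}$ let $\lambda_p(x)\in\{0,1,2,\ldots\}\cup\{+\infty\}$ be the $p$-adic valuation of $x_p$, with $\lambda_p(x)=+\infty$ if $x_p=0$. For a finite multiset $A=\{a_1,\ldots,a_m\}$ of integers let ${\rm LCM}(A)$ be the least common multiple of $|a_1|,\ldots,|a_m|$, with ${\rm LCM}(A)=0$ if $0\in A$. Put ${\rm NLCM}(A)={\rm LCM}(A)/\prod_{i=1}^m|a_i|$ if $0\notin A$, and ${\rm NLCM}(A)={\rm NLCM}(A\setminus\{0\})$ (all zeros removed) otherwise, with ${\rm NLCM}(\emptyset)=1$. For $n\in\mathbb N=\{1,2,\ldots\}$ let $\mathbf U_n^{(s)}$ be uniformly distributed on $\{1,\ldots,n\}^s$. Let $\mathcal V_1,\ldots,\mathcal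 V_s$ be independent random elements of $\widehat{\mathbb Z}$ with distribution $\widehat\mu$. **Theorem 3.2.** Let $m\ge 2$ and let $f_1,\ldots,f_m\in\mathbb Z[x_1,\ldots,x_s]$ be non-zero polynomials such that no two of them, $f_i$ and $f_j$ with $i\ne j$, have a common factor of positive degree. Put $d_i=\deg f_i$, and let $\bar f_i$ be the homogeneous part of $f_i$ of degree $d_i$. Then there is a random variable $L=L_{f_1,\ldots,f_m}$ with values in $1/\mathbb N=\{1,1/2,1/3,\ldots\}$ such that almost surely all $\lambda_p(f_i(\mathcal V_1,\ldots,\mathcal V_s))$ are finite and $$ \log L=\sum_{p\in\mathcal P}\log p\left(\max_{i=1,\ldots,m}\lambda_p(f_i(\mathcal V_1,\ldots,\mathcal V_s))-\sum_{i=1}^m\lambda_p(f_i(\mathcal V_1,\ldots,\mathcal V_s))\right), $$ where the series converges almost surely, and such that, as $n\to\infty$, $$ {\rm NLCM}\bigl(f_1(\mathbf U_n^{(s)}),\ldots,f_m(\mathbf U_n^{(s)})\bigr)\ \overset{\rm d}{\longrightarrow}\ L . $$ Moreover, if $\mathbf U_\infty^{(s)}$ is uniformly distributed on $[0,1]^s$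 and independent of $L$, then, as $n\to\infty$, $$ \frac{{\rm LCM}\bigl(f_1(\mathbf U_n^{(s)}),\ldots,f_m(\mathbf U_n^{(s)})\bigr)}{n^{d_1+\cdots+d_m}}\ \overset{\rm d}{\longrightarrow}\ L\prod_{i=1}^m\bigl|\bar f_i(\mathbf U_\infty^{(s)})\bigr| . $$ -/

import Mathlib

open MeasureTheory ProbabilityTheory Filter

noncomputable section

instance Nat.Primes.instFactPrime (p : Nat.Primes) : Fact (p : ℕ).Prime := ⟨p.2⟩

/-- The ring of `p`-adic integers carries its Borel σ-algebra. -/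
instance PadicInt.instMeasurableSpaceBorel (p : ℕ) [Fact p.Prime] : MeasurableSpace ℤ_[p] :=
  borel _

instance PadicInt.instBorelSpaceBorel (p : ℕ) [Fact p.Prime] : BorelSpace ℤ_[p] := ⟨rfl⟩

/-- The Haar probability measure on the compact group `ℤ_[p]`. -/
def padicHaar (p : ℕ) [Fact p.Prime] : Measure ℤ_[p] :=
  Measure.addHaarMeasure (⊤ : TopologicalSpace.PositiveCompacts ℤ_[p])

instance padicHaar.instIsProbabilityMeasure (p : ℕ) [Fact p.Prime] :
    IsProbabilityMeasure (padicHaar p) := by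
  refine ⟨?_⟩
  have h := Measure.addHaarMeasure_self (K₀ := (⊤ : TopologicalSpace.PositiveCompacts ℤ_[p]))
  simpa [padicHaar] using h

/-- The ring of integer adeles (profinite integers), the product of all `ℤ_[p]`. -/
abbrev IntegerAdeles : Type := (p : Nat.Primes) → ℤ_[(p : ℕ)]

/-- The Haar probability measure on the integer adeles: the product of the Haar probability
measures on the factors `ℤ_[p]`. -/
def adelesHaar : Measure IntegerAdeles :=
  Measure.infinitePi fun p : Nat.Primes => padicHaar (p : ℕ)

/-- The exponent of the prime `p` in the integer adele `x`: the largest `k` such that `p ^ k`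
divides the `p`-th coordinate of `x`, and `⊤` if this coordinate vanishes. -/
def primeExponent (p : Nat.Primes) (x : IntegerAdeles) : ℕ∞ :=
  emultiplicity ((p : ℕ) : ℤ_[(p : ℕ)]) (x p)

/-- The uniform distribution on `{1, …, n} ^ s`. -/
def uniformGrid (s : ℕ) (n : ℕ+) : Measure (Fin s → ℤ) :=
  uniformOn {x | ∀ j, 1 ≤ x j ∧ x j ≤ (n : ℤ)}

/-- The multiset `{f₁(u), …, f_m(u)}`. -/
def polyValues {s m : ℕ} (f : Fin m → MvPolynomial (Fin s) ℤ) (u : Fin s → ℤ) : Multiset ℤ :=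
  Finset.univ.val.map fun i => MvPolynomial.eval u (f i)

/-- The least common multiple of the absolute values of the elements of `A`; it is `0` when `A`
contains `0`. -/
def intLCM (A : Multiset ℤ) : ℕ := (A.map Int.natAbs).lcm

/-- The normalized least common multiple: the zeros are removed from `A` first, and the least
common multiple of the others is divided by the product of their absolute values. -/
def intNLCM (A : Multiset ℤ) : ℝ :=
  (intLCM (A.filter (· ≠ 0)) : ℝ) / (((A.filter (· ≠ 0)).map fun a => |(a : ℝ)|).prod)

/-- The homogeneous part of top degree of a polynomial. -/
def topForm {s : ℕ} (f : MvPolynomial (Fin s) ℤ) : MvPolynomial (Fin s) ℤ :=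
  MvPolynomial.homogeneousComponent f.totalDegree f

end

/-!
Convergence in distribution of the (normalized) least common multiple of polynomial values at
uniform points of the box `{1, …, n} ^ s`.

The normalized least common multiple of non-zero integers is the inverse of a product of prime
powers, the prime `p` having as exponent the `excess` of the exponents of `p` in these integers,
that is, their sum minus their maximum. The excess vanishes unless `p` divides two of the integers.
So the limit is `1 / limitDenominator`, the same expression at independent Haar distributed integer
adeles, and two truncations make the comparison possible.

* Only finitely many primes matter. As any two of the polynomials have no common factor of positive
  degree, eliminating a variable (`NoCommonFactor.exists_C_mem_span`, by Gauss's lemma) shows that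
  they have
  `O(p ^ (s - 2))` common zeros modulo `p` (`exists_card_commonZeros_zmod_le`). This bounds the
  proportion of points of the box at which a prime `p ≤ n` divides two values by a multiple of
  `p ^ (-2)`. Ekedahl's sieve (`exists_card_gridBox_large_prime_le`) treats all primes above `n` at
  once, at the cost of `O(1 / n)`. Together they give `exists_dividesTwo_outside_le`; letting the
  boxes grow transfers the bound for a single prime to adelic points, where
  `ae_finite_adeleDividesTwo` follows by Borel–Cantelli.
* Only bounded powers of these primes matter. An integer polynomial that is not zero has a null set
  of `p`-adic zeros (`ae_aeval_ne_zero`), so its values are rarely divisible by a high power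
  (`tendsto_measure_undetermined`).

After the truncations the normalized least common multiple depends only on the residue modulo
`∏ p ∈ S, p ^ K` (`intNLCM_eq_periodicNLCM`, `inv_limitDenominator_eq_periodicNLCM`). The residues of the
points of large boxes are equidistributed, as are those of Haar distributed adeles, and within each
residue class the rescaled points are equidistributed in the unit cube
(`tendsto_boxAverage_residueClass`). This yields the joint convergence in
`tendsto_boxAverage_intNLCM`, in particular the asymptotic independence of the normalized least
common multiple and the rescaled point.

The least common multiple is the normalized one times the product of the absolute values, and at
scale `n` a polynomial of degree `d` is `n ^ d` times its top form at the rescaled point, up to an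
error `O(n ^ (d - 1))` (`exists_abs_eval_sub_topForm_le`). So both convergence statements are
instances of the joint convergence.
-/

open Topology

/-! ### Families of polynomials without common factor -/

/-- A finite family of integer polynomials that is not identically zero and whose common divisors
are all constant. -/
def NoCommonFactor {s : ℕ} (F : Finset (MvPolynomial (Fin s) ℤ)) : Prop :=
  (∃ f ∈ F, f ≠ 0) ∧ ∀ h : MvPolynomial (Fin s) ℤ, (∀ f ∈ F, h ∣ f) → h.totalDegree = 0

open scoped Classical in
/-- The coefficients, polynomials in the remaining variables, of the members of `F` viewed as
polynomials in the variable `0`. -/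
noncomputable def coeffFamily {s : ℕ} (F : Finset (MvPolynomial (Fin (s + 1)) ℤ)) :
    Finset (MvPolynomial (Fin s) ℤ) :=
  F.biUnion fun f => (MvPolynomial.finSuccEquiv ℤ s f).coeffs

lemma mem_coeffFamily {s : ℕ} {F : Finset (MvPolynomial (Fin (s + 1)) ℤ)}
    {c : MvPolynomial (Fin s) ℤ} :
    c ∈ coeffFamily F ↔ ∃ f ∈ F, c ∈ (MvPolynomial.finSuccEquiv ℤ s f).coeffs := by
  simp [coeffFamily]

lemma MvPolynomial.totalDegree_rename_of_injective {σ τ R : Type*} [CommSemiring R]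
    (p : MvPolynomial σ R) {g : σ → τ} (hg : Function.Injective g) :
    (rename g p).totalDegree = p.totalDegree := by
  classical
  simp only [totalDegree, support_rename_of_injective hg, Finset.sup_image]
  congr 1
  funext d
  exact Finsupp.sum_mapDomain_index (h := fun _ e => e) (fun _ => rfl) fun _ _ _ => rfl

lemma MvPolynomial.finSuccEquiv_symm_C {s : ℕ} (h : MvPolynomial (Fin s) ℤ) :
    (finSuccEquiv ℤ s).symm (Polynomial.C h) = rename Fin.succ h := by
  rw [AlgEquiv.symm_apply_eq]
  induction h using MvPolynomial.induction_on with
  | C a => simp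
  | add p q hp hq => simp [hp, hq]
  | mul_X p i hp => simp [hp, finSuccEquiv_X_succ]

/-- A common divisor of the coefficients divides the family, so eliminating a variable by passing to
the coefficients preserves the absence of common factors. -/
lemma NoCommonFactor.coeffFamily {s : ℕ} {F : Finset (MvPolynomial (Fin (s + 1)) ℤ)}
    (hF : NoCommonFactor F) : NoCommonFactor (coeffFamily F) := by
  obtain ⟨⟨f, hf, hf0⟩, hF⟩ := hF
  refine ⟨?_, fun h hh => ?_⟩
  · have h0 : MvPolynomial.finSuccEquiv ℤ s f ≠ 0 := by simpa using hf0
    refine ⟨_, mem_coeffFamily.2 ⟨f, hf, Polynomial.coeff_mem_coeffs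
      (Polynomial.leadingCoeff_ne_zero.2 h0)⟩, Polynomial.leadingCoeff_ne_zero.2 h0⟩
  · rw [← h.totalDegree_rename_of_injective (Fin.succ_injective s)]
    refine hF _ ?_
    intro g hg
    rw [← MvPolynomial.finSuccEquiv_symm_C, ← map_dvd_iff (MvPolynomial.finSuccEquiv ℤ s),
      AlgEquiv.apply_symm_apply, Polynomial.C_dvd_iff_dvd_coeff]
    intro k
    by_cases hk : (MvPolynomial.finSuccEquiv ℤ s g).coeff k = 0
    · simp [hk]
    · exact hh _ (mem_coeffFamily.2 ⟨g, hg, Polynomial.coeff_mem_coeffs hk⟩)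

/-- Elimination of the variable `0`: over the fraction field of the coefficients a family without
common factor generates the unit ideal (Gauss's lemma), and clearing denominators leaves a
non-zero element free of that variable. -/
lemma NoCommonFactor.exists_C_mem_span {s : ℕ} {F : Finset (MvPolynomial (Fin (s + 1)) ℤ)}
    (hF : NoCommonFactor F) :
    ∃ r : MvPolynomial (Fin s) ℤ, r ≠ 0 ∧
      Polynomial.C r ∈ Ideal.span (MvPolynomial.finSuccEquiv ℤ s '' (F : Set _)) := by
  obtain ⟨⟨f, hf, hf0⟩, hF⟩ := hF
  let R := MvPolynomial (Fin s) ℤ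
  let K := FractionRing R
  let φ := MvPolynomial.finSuccEquiv ℤ s
  let I : Ideal (Polynomial R) := Ideal.span (φ '' (F : Set _))
  let _ : Algebra (Polynomial R) (Polynomial K) := Polynomial.algebra R K
  have : IsLocalization (Submonoid.map Polynomial.C (nonZeroDivisors R)) (Polynomial K) :=
    Polynomial.isLocalization (nonZeroDivisors R) K
  have htop : I.map (algebraMap (Polynomial R) (Polynomial K)) = ⊤ := by
    obtain ⟨g, hg⟩ := (IsPrincipalIdealRing.principal
      (I.map (algebraMap (Polynomial R) (Polynomial K)))).principal
    rw [hg]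
    change Ideal.span {g} = ⊤
    rw [Ideal.span_singleton_eq_top]
    have hdvd : ∀ q ∈ F, g ∣ (φ q).map (algebraMap R K) := by
      intro q hq
      have : (φ q).map (algebraMap R K) ∈ I.map (algebraMap (Polynomial R) (Polynomial K)) :=
        Ideal.mem_map_of_mem _ (Ideal.subset_span ⟨q, hq, rfl⟩)
      rw [hg] at this
      exact Ideal.mem_span_singleton.1 this
    have hφf : (φ f).map (algebraMap R K) ≠ 0 := by
      rw [Ne, Polynomial.map_eq_zero_iff (IsFractionRing.injective R K)]
      simpa [φ] using hf0
    have hg0 : g ≠ 0 := fun h => hφf (by simpa [h] using hdvd f hf)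
    let _ : NormalizedGCDMonoid R := Classical.choice inferInstance
    by_contra hunit
    obtain ⟨b, hb, hbg⟩ := IsLocalization.integerNormalization_spec (nonZeroDivisors R) g
    set g₁ := IsLocalization.integerNormalization (nonZeroDivisors R) g with hg₁
    have hg₁0 : g₁ ≠ 0 := by
      rw [hg₁, Ne, IsFractionRing.integerNormalization_eq_zero_iff]
      exact hg0
    have hb0 : algebraMap R K b ≠ 0 := by
      rw [Ne, IsFractionRing.to_map_eq_zero_iff]
      exact nonZeroDivisors.ne_zero hb
    have hb' : g₁.map (algebraMap R K) = Polynomial.C (algebraMap R K b) * g := by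
      rw [hbg, ← Polynomial.smul_eq_C_mul, algebraMap_smul]
    -- the primitive part of the integral multiple `g₁` of `g` divides the whole family over `R`
    have hprim : ∀ q ∈ F, g₁.primPart ∣ φ q := by
      intro q hq
      refine g₁.isPrimitive_primPart.dvd_of_fraction_map_dvd_fraction_map (K := K) ?_
      have h1 : g₁.primPart.map (algebraMap R K) ∣ Polynomial.C (algebraMap R K b) * g := by
        rw [← hb']
        exact Polynomial.map_dvd _ ⟨Polynomial.C g₁.content, by
          rw [mul_comm]; exact g₁.eq_C_content_mul_primPart⟩
      have h2 : IsUnit (Polynomial.C (algebraMap R K b)) :=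
        Polynomial.isUnit_C.2 (isUnit_iff_ne_zero.2 hb0)
      exact (h2.dvd_mul_left.1 h1).trans (hdvd q hq)
    have hdeg := hF (φ.symm g₁.primPart) fun q hq => by
      rw [← map_dvd_iff φ, AlgEquiv.apply_symm_apply]
      exact hprim q hq
    have hnat : g₁.natDegree = 0 := by
      rw [← Polynomial.natDegree_primPart, ← AlgEquiv.apply_symm_apply φ g₁.primPart]
      exact Nat.le_zero.1 ((MvPolynomial.natDegree_finSuccEquiv _).trans_le
        ((MvPolynomial.degreeOf_le_totalDegree _ _).trans_eq hdeg))
    have hgnat : g.natDegree = 0 := by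
      rw [← Polynomial.natDegree_C_mul hb0, ← hb',
        Polynomial.natDegree_map_eq_of_injective (IsFractionRing.injective R K), hnat]
    rw [Polynomial.eq_C_of_natDegree_eq_zero hgnat] at hunit hg0
    exact hunit (Polynomial.isUnit_C.2 (isUnit_iff_ne_zero.2 fun h => hg0 (by simp [h])))
  have := mt (IsLocalization.map_algebraMap_ne_top_iff_disjoint
    (Submonoid.map Polynomial.C (nonZeroDivisors R)) (Polynomial K) I).2 (not_not.2 htop)
  rw [Set.not_disjoint_iff] at this
  obtain ⟨_, ⟨r, hr, rfl⟩, hrI⟩ := this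
  exact ⟨r, nonZeroDivisors.ne_zero hr, hrI⟩

/-! ### Common zeros modulo a prime -/

/-- The integer points of the box `{1, …, n} ^ s`. -/
noncomputable def gridBox (s n : ℕ) : Finset (Fin s → ℤ) :=
  Fintype.piFinset fun _ => Finset.Icc 1 (n : ℤ)

lemma mem_gridBox {s n : ℕ} {u : Fin s → ℤ} : u ∈ gridBox s n ↔ ∀ j, 1 ≤ u j ∧ u j ≤ n := by
  simp [gridBox]

lemma card_gridBox (s n : ℕ) : (gridBox s n).card = n ^ s := by
  simp [gridBox]

lemma MvPolynomial.intCast_eval {s : ℕ} {A : Type*} [CommRing A] (u : Fin s → ℤ)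
    (f : MvPolynomial (Fin s) ℤ) : ((eval u f : ℤ) : A) = aeval (fun j => (u j : A)) f := by
  induction f using MvPolynomial.induction_on with
  | C a => simp
  | add p q hp hq => simp [hp, hq]
  | mul_X p i hp => simp [hp]

lemma MvPolynomial.dvd_eval_iff {s : ℕ} (q : ℕ) (u : Fin s → ℤ)
    (f : MvPolynomial (Fin s) ℤ) :
    (q : ℤ) ∣ eval u f ↔ aeval (fun j => (u j : ZMod q)) f = 0 := by
  rw [← intCast_eval, ZMod.intCast_zmod_eq_zero_iff_dvd]

section Fibres

variable {s : ℕ} {A : Type*} [CommRing A]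

lemma MvPolynomial.aeval_cons (y : A) (a' : Fin s → A) (f : MvPolynomial (Fin (s + 1)) ℤ) :
    aeval (Fin.cons y a' : Fin (s + 1) → A) f =
      (finSuccEquiv ℤ s f).eval₂ (aeval a' : MvPolynomial (Fin s) ℤ →ₐ[ℤ] A).toRingHom y := by
  induction f using MvPolynomial.induction_on with
  | C a =>
    simp only [map_intCast, eq_intCast]
    exact (map_intCast (Polynomial.eval₂RingHom
      (aeval a' : MvPolynomial (Fin s) ℤ →ₐ[ℤ] A).toRingHom y) a).symm
  | add p q hp hq => simp [hp, hq]
  | mul_X p i hp =>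
    refine Fin.cases ?_ (fun i => ?_) i <;>
    simp [hp, finSuccEquiv_X_succ, finSuccEquiv_X_zero, Polynomial.eval₂_mul]

/-- An element of the ideal of the family that is free of the variable `0` vanishes at the
projections of the common zeros. -/
lemma aeval_eq_zero_of_C_mem_span {F : Finset (MvPolynomial (Fin (s + 1)) ℤ)}
    {r : MvPolynomial (Fin s) ℤ}
    (hr : Polynomial.C r ∈ Ideal.span (MvPolynomial.finSuccEquiv ℤ s '' (F : Set _)))
    {y : A} {a : Fin s → A}
    (h : ∀ f ∈ F, MvPolynomial.aeval (Fin.cons y a : Fin (s + 1) → A) f = 0) :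
    MvPolynomial.aeval a r = 0 := by
  let φ := Polynomial.eval₂RingHom
    (MvPolynomial.aeval a : MvPolynomial (Fin s) ℤ →ₐ[ℤ] A).toRingHom y
  have hle : Ideal.span (MvPolynomial.finSuccEquiv ℤ s '' (F : Set _)) ≤ RingHom.ker φ := by
    rw [Ideal.span_le]
    rintro _ ⟨f, hf, rfl⟩
    simpa [φ, RingHom.mem_ker, MvPolynomial.aeval_cons] using h f hf
  simpa [φ, RingHom.mem_ker] using hle hr

/-- Above a point where some coefficient of the family does not vanish, the number of common
zeros is bounded by the degrees in the eliminated variable. -/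
lemma card_fibre_le [IsDomain A] {F : Finset (MvPolynomial (Fin (s + 1)) ℤ)} {a : Fin s → A}
    (ha : ¬ ∀ c ∈ coeffFamily F, MvPolynomial.aeval a c = 0) {Y : Finset A}
    (hY : ∀ y ∈ Y, ∀ f ∈ F, MvPolynomial.aeval (Fin.cons y a : Fin (s + 1) → A) f = 0) :
    Y.card ≤ ∑ f ∈ F, (MvPolynomial.finSuccEquiv ℤ s f).natDegree := by
  classical
  push Not at ha
  obtain ⟨c, hc, hca⟩ := ha
  obtain ⟨f, hf, hcf⟩ := mem_coeffFamily.1 hc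
  obtain ⟨k, -, rfl⟩ := Polynomial.mem_coeffs_iff.1 hcf
  set q := (MvPolynomial.finSuccEquiv ℤ s f).map
    (MvPolynomial.aeval a : MvPolynomial (Fin s) ℤ →ₐ[ℤ] A).toRingHom with hq
  have hq0 : q ≠ 0 := fun h => hca (by
    have : q.coeff k = 0 := by simp [h]
    simpa [hq, Polynomial.coeff_map] using this)
  have hsub : Y ⊆ q.roots.toFinset := fun y hy => by
    rw [Multiset.mem_toFinset, Polynomial.mem_roots hq0, Polynomial.IsRoot, hq,
      Polynomial.eval_map, ← MvPolynomial.aeval_cons]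
    exact hY y hy f hf
  calc Y.card ≤ q.roots.toFinset.card := Finset.card_le_card hsub
    _ ≤ q.roots.card := Multiset.toFinset_card_le _
    _ ≤ q.natDegree := q.card_roots'
    _ ≤ (MvPolynomial.finSuccEquiv ℤ s f).natDegree := Polynomial.natDegree_map_le
    _ ≤ _ := Finset.single_le_sum
      (f := fun f => (MvPolynomial.finSuccEquiv ℤ s f).natDegree) (fun _ _ => Nat.zero_le _) hf

end Fibres

lemma card_le_of_fibres {s : ℕ} {A : Type*} (Z : Finset (Fin (s + 1) → A))
    (T : Finset (Fin s → A)) (N : ℕ)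
    (hZT : ∀ v ∈ Z, Fin.tail v ∈ T)
    (hN : ∀ a ∈ T, ∀ Y : Finset A, (∀ y ∈ Y, (Fin.cons y a : Fin (s + 1) → A) ∈ Z) →
      Y.card ≤ N) : Z.card ≤ N * T.card := by
  classical
  refine Finset.card_le_mul_card_image_of_maps_to hZT N fun a ha => ?_
  have hinj : Set.InjOn (fun v : Fin (s + 1) → A => v 0) ({v ∈ Z | Fin.tail v = a} : Finset _) := by
    intro v hv w hw h
    simp only [Finset.coe_filter, Set.mem_ofPred_eq] at hv hw
    rw [← Fin.cons_self_tail v, ← Fin.cons_self_tail w, hv.2, hw.2]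
    simp only at h
    rw [h]
  rw [← Finset.card_image_of_injOn hinj]
  refine hN a ha _ fun y hy => ?_
  obtain ⟨v, hv, rfl⟩ := Finset.mem_image.1 hy
  obtain ⟨hv, rfl⟩ := Finset.mem_filter.1 hv
  simpa using hv

open scoped Classical in
/-- The Schwartz–Zippel bound `O(p ^ (s - 1))`, made uniform in `p`: for the finitely many `p`
modulo which `r` vanishes identically the trivial bound is absorbed in the constant. -/
lemma exists_card_zeros_zmod_le {s : ℕ} {r : MvPolynomial (Fin s) ℤ} (hr : r ≠ 0) :
    ∃ C : ℕ, ∀ (p : ℕ) [Fact p.Prime],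
      p * (Finset.univ.filter fun a : Fin s → ZMod p => MvPolynomial.aeval a r = 0).card
        ≤ C * p ^ s := by
  obtain ⟨d, hd⟩ := MvPolynomial.ne_zero_iff.1 hr
  refine ⟨r.totalDegree + (r.coeff d).natAbs, fun p hp => ?_⟩
  have : NeZero p := ⟨hp.out.ne_zero⟩
  set r' := MvPolynomial.map (Int.castRingHom (ZMod p)) r with hr'
  by_cases h0 : r' = 0
  · -- only the finitely many primes dividing the coefficients of `r` are of this kind
    have hpd : (p : ℤ) ∣ r.coeff d := by
      rw [← ZMod.intCast_zmod_eq_zero_iff_dvd]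
      have : r'.coeff d = 0 := by rw [h0, MvPolynomial.coeff_zero]
      simpa [hr', MvPolynomial.coeff_map] using this
    have hp1 : p ≤ (r.coeff d).natAbs :=
      Nat.le_of_dvd (Int.natAbs_pos.2 hd) (Int.natCast_dvd.1 hpd)
    refine Nat.mul_le_mul (by omega) ((Finset.card_le_univ _).trans_eq ?_)
    simp [ZMod.card]
  · have h1 := MvPolynomial.schwartz_zippel_totalDegree h0 (Finset.univ : Finset (ZMod p))
    have hp0 : (0 : NNRat) < p := by exact_mod_cast hp.out.pos
    rw [Finset.card_univ, ZMod.card, div_le_div_iff₀ (by positivity) hp0] at h1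
    have h2 : (Finset.univ.filter fun a : Fin s → ZMod p => MvPolynomial.aeval a r = 0).card * p
        ≤ r'.totalDegree * p ^ s := by
      have h3 : (Finset.univ.filter fun a : Fin s → ZMod p => MvPolynomial.aeval a r = 0) =
          (Fintype.piFinset fun _ : Fin s => (Finset.univ : Finset (ZMod p))).filter
            fun a => MvPolynomial.eval a r' = 0 := by
        ext a
        rw [Finset.mem_filter]
        simp only [Finset.mem_filter, Finset.mem_univ, true_and, Fintype.mem_piFinset,
          implies_true, hr', MvPolynomial.eval_map, MvPolynomial.aeval_def, algebraMap_int_eq]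
      rw [h3]
      exact_mod_cast h1
    rw [mul_comm]
    refine h2.trans (Nat.mul_le_mul_right _ (le_trans ?_ (Nat.le_add_right _ _)))
    exact Finset.sup_mono (MvPolynomial.support_map_subset _ _)

open scoped Classical in
/-- A family without common factor has `O(p ^ (s - 2))` common zeros modulo `p`, uniformly in `p`.
Projecting away the variable `0`, either the coefficients all vanish at the image point, and
induction applies to them, or the fibre is bounded and the image point is a zero of an element of
the elimination ideal. -/
lemma exists_card_commonZeros_zmod_le {s : ℕ} {F : Finset (MvPolynomial (Fin s) ℤ)}
    (hF : NoCommonFactor F) :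
    ∃ C : ℕ, ∀ (p : ℕ) [Fact p.Prime],
      p ^ 2 * (Finset.univ.filter fun a : Fin s → ZMod p =>
        ∀ f ∈ F, MvPolynomial.aeval a f = 0).card ≤ C * p ^ s := by
  induction s with
  | zero =>
    obtain ⟨f, hf, hf0⟩ := hF.1
    obtain ⟨c, rfl⟩ := MvPolynomial.C_surjective (Fin 0) f
    have hc : c ≠ 0 := by simpa using hf0
    refine ⟨c.natAbs ^ 2, fun p hp => ?_⟩
    have : NeZero p := ⟨hp.out.ne_zero⟩
    by_cases hpc : (p : ℤ) ∣ c
    · have hp1 : p ≤ c.natAbs := Nat.le_of_dvd (Int.natAbs_pos.2 hc) (Int.natCast_dvd.1 hpc)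
      refine Nat.mul_le_mul (Nat.pow_le_pow_left hp1 2) ((Finset.card_le_univ _).trans_eq ?_)
      simp
    · rw [Finset.card_eq_zero.2]
      · simp
      · rw [Finset.filter_eq_empty_iff]
        intro a _ h
        have := h _ hf
        rw [MvPolynomial.aeval_C, algebraMap_int_eq, eq_intCast,
          ZMod.intCast_zmod_eq_zero_iff_dvd] at this
        exact hpc this
  | succ s ih =>
    obtain ⟨C₁, hC₁⟩ := ih hF.coeffFamily
    obtain ⟨r, hr0, hr⟩ := hF.exists_C_mem_span
    obtain ⟨C₂, hC₂⟩ := exists_card_zeros_zmod_le hr0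
    set D := ∑ f ∈ F, (MvPolynomial.finSuccEquiv ℤ s f).natDegree with hD
    refine ⟨C₁ + D * C₂, fun p hp => ?_⟩
    have : NeZero p := ⟨hp.out.ne_zero⟩
    set Z := Finset.univ.filter fun a : Fin (s + 1) → ZMod p =>
        ∀ f ∈ F, MvPolynomial.aeval a f = 0 with hZ
    have hcons : ∀ v ∈ Z, ∀ f ∈ F,
        MvPolynomial.aeval (Fin.cons (v 0) (Fin.tail v) : Fin (s + 1) → ZMod p) f = 0 := by
      intro v hv
      rw [Fin.cons_self_tail]
      exact (Finset.mem_filter.1 hv).2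
    have h1 : (Z.filter fun v => ∀ c ∈ coeffFamily F, MvPolynomial.aeval (Fin.tail v) c = 0).card
        ≤ p * (Finset.univ.filter fun a : Fin s → ZMod p =>
          ∀ c ∈ coeffFamily F, MvPolynomial.aeval a c = 0).card := by
      refine card_le_of_fibres _ _ _ (fun v hv => ?_) fun a _ Y _ => ?_
      · exact Finset.mem_filter.2 ⟨Finset.mem_univ _, (Finset.mem_filter.1 hv).2⟩
      · exact (Finset.card_le_univ _).trans_eq (ZMod.card p)
    have h2 : (Z.filter fun v => ¬ ∀ c ∈ coeffFamily F,
        MvPolynomial.aeval (Fin.tail v) c = 0).card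
        ≤ D * (Finset.univ.filter fun a : Fin s → ZMod p => MvPolynomial.aeval a r = 0).card := by
      refine card_le_of_fibres _ _ _ (fun v hv => ?_) fun a _ Y hY => ?_
      · exact Finset.mem_filter.2 ⟨Finset.mem_univ _,
          aeval_eq_zero_of_C_mem_span hr (hcons v (Finset.mem_filter.1 hv).1)⟩
      · rcases Y.eq_empty_or_nonempty with rfl | ⟨y, hy⟩
        · simp
        · have hay := (Finset.mem_filter.1 (hY y hy)).2
          rw [Fin.tail_cons] at hay
          exact card_fibre_le hay fun y hy =>
            (Finset.mem_filter.1 (Finset.mem_filter.1 (hY y hy)).1).2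
    rw [← Finset.card_filter_add_card_filter_not (s := Z)
      (fun v => ∀ c ∈ coeffFamily F, MvPolynomial.aeval (Fin.tail v) c = 0)]
    calc _ ≤ p ^ 2 * (p * _ + D * _) := Nat.mul_le_mul_left _ (add_le_add h1 h2)
      _ = p * (p ^ 2 * _) + (D * p) * (p * _) := by ring
      _ ≤ p * (C₁ * p ^ s) + (D * p) * (C₂ * p ^ s) :=
        add_le_add (Nat.mul_le_mul_left _ (hC₁ p)) (Nat.mul_le_mul_left _ (hC₂ p))
      _ = _ := by ring

/-! ### Ekedahl's sieve -/

lemma MvPolynomial.dvd_eval_cons_iff {s : ℕ} (q : ℕ) (y : ℤ) (a : Fin s → ℤ)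
    (f : MvPolynomial (Fin (s + 1)) ℤ) :
    (q : ℤ) ∣ eval (Fin.cons y a : Fin (s + 1) → ℤ) f ↔
      aeval (Fin.cons (y : ZMod q) (fun j => (a j : ZMod q)) : Fin (s + 1) → ZMod q) f = 0 := by
  rw [dvd_eval_iff]
  have : (fun j => ((Fin.cons y a : Fin (s + 1) → ℤ) j : ZMod q)) =
      Fin.cons (y : ZMod q) (fun j => (a j : ZMod q)) := by
    funext j
    refine Fin.cases ?_ (fun j => ?_) j <;> simp
  rw [this]

lemma card_residueClass_Icc_le (n p : ℕ) (hp : 0 < p) (a : ZMod p) :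
    ((Finset.Icc 1 (n : ℤ)).filter fun x : ℤ => (x : ZMod p) = a).card ≤ n / p + 1 := by
  obtain ⟨v, rfl⟩ := ZMod.intCast_surjective a
  have h1 : ((Finset.Icc 1 (n : ℤ)).filter fun x : ℤ => (x : ZMod p) = v) =
      (Finset.Ioc 0 (n : ℤ)).filter fun x => x ≡ v [ZMOD p] := by
    ext x
    simp only [Finset.mem_filter, Finset.mem_Icc, Finset.mem_Ioc, ZMod.intCast_eq_intCast_iff]
    constructor <;> rintro ⟨⟨h1, h2⟩, h3⟩ <;> exact ⟨⟨by omega, h2⟩, h3⟩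
  have hp' : (0 : ℤ) < p := by exact_mod_cast hp
  have h2 := Int.Ioc_filter_modEq_card 0 (n : ℤ) hp' v
  rw [← h1] at h2
  have hpq : (0 : ℚ) < p := by exact_mod_cast hp
  have h3 : (⌊(((n : ℤ) - v : ℤ) : ℚ) / ((p : ℤ) : ℚ)⌋ : ℤ) = ((n : ℤ) - v) / p := by
    exact Rat.floor_intCast_div_natCast _ p
  have h4 : (⌊(((0 : ℤ) - v : ℤ) : ℚ) / ((p : ℤ) : ℚ)⌋ : ℤ) = ((0 : ℤ) - v) / p := by
    exact Rat.floor_intCast_div_natCast _ p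
  push_cast at h2 h3 h4
  rw [h3, h4] at h2
  have h5 : ((n : ℤ) - v) / p ≤ (n : ℤ) / p + (0 - v) / p + 1 := by
    have e1 := Int.emod_add_mul_ediv (n : ℤ) p
    have e2 := Int.emod_add_mul_ediv (0 - v) p
    have l1 := Int.emod_lt_of_pos (n : ℤ) hp'
    have l2 := Int.emod_lt_of_pos (0 - v) hp'
    refine Int.le_of_lt_add_one (Int.ediv_lt_of_lt_mul hp' ?_)
    nlinarith
  have h6 : ((((Finset.Icc 1 (n : ℤ)).filter fun x : ℤ => (x : ZMod p) = v).card : ℕ) : ℤ) ≤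
      ((n / p + 1 : ℕ) : ℤ) := by
    rw [h2]
    push_cast
    refine max_le (by linarith) (by positivity)
  exact_mod_cast h6

lemma card_residueClass_gridBox_le {s : ℕ} (n p : ℕ) (hp : 0 < p) (a : Fin s → ZMod p) :
    ((gridBox s n).filter fun u => (fun j => (u j : ZMod p)) = a).card ≤ (n / p + 1) ^ s := by
  have h : ((gridBox s n).filter fun u => (fun j => (u j : ZMod p)) = a) ⊆
      Fintype.piFinset fun j => (Finset.Icc 1 (n : ℤ)).filter fun x : ℤ => (x : ZMod p) = a j := by
    intro u hu
    simp only [gridBox, Finset.mem_filter, Fintype.mem_piFinset, funext_iff] at hu ⊢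
    exact fun j => ⟨hu.1 j, hu.2 j⟩
  refine (Finset.card_le_card h).trans ?_
  rw [Fintype.card_piFinset]
  refine (Finset.prod_le_pow_card _ _ _ fun j _ => card_residueClass_Icc_le n p hp (a j)).trans_eq
    (by rw [Finset.card_univ, Fintype.card_fin])

/-- Sieve bound for the primes up to the side of the box: a box with side `n ≥ p` meets each residue
class modulo `p` in at most `(2 * n / p) ^ s` points. -/
lemma exists_card_gridBox_dvd_le {s : ℕ} {F : Finset (MvPolynomial (Fin s) ℤ)}
    (hF : NoCommonFactor F) :
    ∃ C : ℕ, ∀ (n p : ℕ), p.Prime → p ≤ n →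
      p ^ 2 * ((gridBox s n).filter fun u =>
        ∀ f ∈ F, (p : ℤ) ∣ MvPolynomial.eval u f).card ≤ C * n ^ s := by
  classical
  obtain ⟨C, hC⟩ := exists_card_commonZeros_zmod_le hF
  refine ⟨C * 2 ^ s, fun n p hp hpn => ?_⟩
  have : Fact p.Prime := ⟨hp⟩
  have : NeZero p := ⟨hp.ne_zero⟩
  set Z := Finset.univ.filter fun a : Fin s → ZMod p =>
        ∀ f ∈ F, MvPolynomial.aeval a f = 0 with hZ
  have h1 : ((gridBox s n).filter fun u => ∀ f ∈ F, (p : ℤ) ∣ MvPolynomial.eval u f).card ≤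
      (n / p + 1) ^ s * Z.card := by
    refine Finset.card_le_mul_card_image_of_maps_to (f := fun u j => (u j : ZMod p))
      (fun u hu => ?_) _ fun a _ => ?_
    · refine Finset.mem_filter.2 ⟨Finset.mem_univ _, fun f hf => ?_⟩
      rw [← MvPolynomial.dvd_eval_iff]
      exact (Finset.mem_filter.1 hu).2 f hf
    · refine le_trans (Finset.card_le_card ?_) (card_residueClass_gridBox_le n p hp.pos a)
      exact Finset.filter_subset_filter _ (Finset.filter_subset _ _)
  have h2 : (p * (n / p + 1)) ^ s ≤ (2 * n) ^ s := by
    refine Nat.pow_le_pow_left ?_ s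
    have := Nat.mul_div_le n p
    rw [mul_add]
    omega
  have hps : 0 < p ^ s := pow_pos hp.pos s
  refine Nat.le_of_mul_le_mul_right ?_ hps
  calc _ ≤ p ^ 2 * ((n / p + 1) ^ s * Z.card) * p ^ s := by gcongr
    _ = (p ^ 2 * Z.card) * (p * (n / p + 1)) ^ s := by rw [mul_pow]; ring
    _ ≤ (C * p ^ s) * (2 * n) ^ s := Nat.mul_le_mul (hC p) h2
    _ = _ := by rw [mul_pow]; ring

lemma card_gridBox_eval_eq_zero_le {s : ℕ} {r : MvPolynomial (Fin s) ℤ} (hr : r ≠ 0)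
    (n : ℕ) (hn : 0 < n) :
    n * ((gridBox s n).filter fun u => MvPolynomial.eval u r = 0).card ≤
      r.totalDegree * n ^ s := by
  have h1 := MvPolynomial.schwartz_zippel_totalDegree hr (Finset.Icc 1 (n : ℤ))
  have hn0 : (0 : NNRat) < n := by exact_mod_cast hn
  simp only [Int.card_Icc, add_sub_cancel_right, Int.toNat_natCast] at h1
  rw [div_le_div_iff₀ (by positivity) hn0] at h1
  rw [mul_comm]
  exact_mod_cast h1

lemma exists_natAbs_eval_le {s : ℕ} (f : MvPolynomial (Fin s) ℤ) :
    ∃ C : ℕ, ∀ n : ℕ, 0 < n → ∀ u ∈ gridBox s n,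
      (MvPolynomial.eval u f).natAbs ≤ C * n ^ f.totalDegree := by
  refine ⟨∑ d ∈ f.support, (f.coeff d).natAbs, fun n hn u hu => ?_⟩
  rw [MvPolynomial.eval_eq', Finset.sum_mul]
  refine (Int.natAbs_sum_le _ _).trans (Finset.sum_le_sum fun d hd => ?_)
  rw [Int.natAbs_mul]
  refine Nat.mul_le_mul_left _ ?_
  rw [show (∏ j, u j ^ d j).natAbs = ∏ j, (u j ^ d j).natAbs from map_prod Int.natAbsHom _ _]
  calc ∏ j, (u j ^ d j).natAbs ≤ ∏ j, n ^ d j := by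
        refine Finset.prod_le_prod' fun j _ => ?_
        rw [Int.natAbs_pow]
        have := mem_gridBox.1 hu j
        exact Nat.pow_le_pow_left (by omega) _
    _ = n ^ ∑ j, d j := Finset.prod_pow_eq_pow_sum _ _ _
    _ ≤ n ^ f.totalDegree := by
        refine Nat.pow_le_pow_right hn ?_
        have := MvPolynomial.le_totalDegree hd
        rwa [Finsupp.sum_fintype _ _ fun _ => rfl] at this

/-- An integer of polynomial size in `n` has boundedly many prime factors above `n`. -/
lemma card_primeFactors_gt_le {n N C e : ℕ} (hn : 2 ≤ n) (hN : N ≠ 0) (h : N ≤ C * n ^ e) :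
    (N.primeFactors.filter (n < ·)).card ≤ e + C := by
  by_contra! hlt
  set T := N.primeFactors.filter (n < ·)
  have h1 : n ^ T.card ≤ N := by
    calc n ^ T.card ≤ ∏ p ∈ T, p :=
          Finset.pow_card_le_prod _ _ _ fun p hp => (Finset.mem_filter.1 hp).2.le
      _ ≤ N := Nat.le_of_dvd (Nat.pos_of_ne_zero hN)
          ((Finset.prod_dvd_prod_of_subset _ _ _ (Finset.filter_subset _ _)).trans
            (Nat.prod_primeFactors_dvd N))
  have h2 : C < n ^ C := Nat.lt_pow_self (by omega)
  have h3 : n ^ (e + C) ≤ n ^ T.card := Nat.pow_le_pow_right (by omega) hlt.le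
  have h4 : 0 < n ^ e := by positivity
  rw [pow_add] at h3
  nlinarith

open scoped Classical in
/-- Ekedahl's sieve: the points of the box at which a family without common factor has a common
prime factor larger than the side of the box are negligible. If such a prime `p` does not divide all
the coefficients at the projected point `a`, it divides the non-zero integer `r a` for a fixed `r`
in the elimination ideal, which leaves boundedly many choices of `p`, and each `p` leaves boundedly
many points above `a` because the side of the box is less than `p`. -/
lemma exists_card_gridBox_large_prime_le {s : ℕ} {F : Finset (MvPolynomial (Fin s) ℤ)}
    (hF : NoCommonFactor F) :
    ∃ C : ℕ, ∀ n : ℕ, 0 < n →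
      n * ((gridBox s n).filter fun u => ∃ p : ℕ, p.Prime ∧ n < p ∧
        ∀ f ∈ F, (p : ℤ) ∣ MvPolynomial.eval u f).card ≤ C * n ^ s := by
  induction s with
  | zero =>
    obtain ⟨f, hf, hf0⟩ := hF.1
    obtain ⟨c, rfl⟩ := MvPolynomial.C_surjective (Fin 0) f
    have hc : c ≠ 0 := by simpa using hf0
    refine ⟨c.natAbs, fun n hn => ?_⟩
    by_cases hnc : n ≤ c.natAbs
    · exact Nat.mul_le_mul hnc ((Finset.card_filter_le _ _).trans_eq (card_gridBox 0 n))
    · rw [Finset.card_eq_zero.2]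
      · simp
      · rw [Finset.filter_eq_empty_iff]
        rintro u _ ⟨p, -, hnp, h⟩
        have := h _ hf
        rw [MvPolynomial.eval_C] at this
        have := Nat.le_of_dvd (Int.natAbs_pos.2 hc) (Int.natCast_dvd.1 this)
        omega
  | succ s ih =>
    obtain ⟨C₁, hC₁⟩ := ih hF.coeffFamily
    obtain ⟨r, hr0, hr⟩ := hF.exists_C_mem_span
    obtain ⟨C₂, hC₂⟩ := exists_natAbs_eval_le r
    set D := ∑ f ∈ F, (MvPolynomial.finSuccEquiv ℤ s f).natDegree with hD
    set B := (r.totalDegree + C₂) * D with hB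
    refine ⟨C₁ + r.totalDegree + B + 1, fun n hn => ?_⟩
    -- the box with side `1` is a single point; the bound on prime factors needs `2 ≤ n`
    rcases (show n = 1 ∨ 2 ≤ n by omega) with rfl | hn2
    · refine (Nat.mul_le_mul_left 1 ((Finset.card_filter_le _ _).trans_eq
        (card_gridBox _ 1))).trans ?_
      simp
    set Z := (gridBox (s + 1) n).filter fun u => ∃ p : ℕ, p.Prime ∧ n < p ∧
        ∀ f ∈ F, (p : ℤ) ∣ MvPolynomial.eval u f with hZ
    set T₁ := (gridBox s n).filter fun u => ∃ p : ℕ, p.Prime ∧ n < p ∧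
        ∀ f ∈ coeffFamily F, (p : ℤ) ∣ MvPolynomial.eval u f with hT₁
    set T₂ := (gridBox s n).filter fun u => MvPolynomial.eval u r = 0 with hT₂
    have htail : ∀ v ∈ gridBox (s + 1) n, (Fin.tail v : Fin s → ℤ) ∈ gridBox s n := fun v hv =>
      mem_gridBox.2 fun j => mem_gridBox.1 hv j.succ
    have hside : ∀ (a : Fin s → ℤ) (Y : Finset ℤ),
        (∀ y ∈ Y, (Fin.cons y a : Fin (s + 1) → ℤ) ∈ gridBox (s + 1) n) →
        Y ⊆ Finset.Icc 1 (n : ℤ) := fun a Y hY y hy => by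
      simpa using mem_gridBox.1 (hY y hy) 0
    have h1 : (Z.filter fun v => (Fin.tail v : Fin s → ℤ) ∈ T₁ ∪ T₂).card ≤ n * (T₁ ∪ T₂).card := by
      refine card_le_of_fibres _ _ _ (fun v hv => (Finset.mem_filter.1 hv).2) fun a _ Y hY => ?_
      refine (Finset.card_le_card (hside a Y fun y hy => ?_)).trans_eq (by simp)
      exact (Finset.mem_filter.1 (Finset.mem_filter.1 (hY y hy)).1).1
    have h2 : (Z.filter fun v => ¬ (Fin.tail v : Fin s → ℤ) ∈ T₁ ∪ T₂).card ≤
        B * (gridBox s n).card := by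
      refine card_le_of_fibres _ _ _ (fun v hv => htail v ?_) fun a ha Y hY => ?_
      · exact (Finset.mem_filter.1 (Finset.mem_filter.1 hv).1).1
      rcases Y.eq_empty_or_nonempty with rfl | ⟨y₀, hy₀⟩
      · simp
      have haT := (Finset.mem_filter.1 (hY y₀ hy₀)).2
      rw [Fin.tail_cons, Finset.mem_union, not_or] at haT
      have har : MvPolynomial.eval a r ≠ 0 := fun h => haT.2 (Finset.mem_filter.2 ⟨ha, h⟩)
      have hYn : Y ⊆ Finset.Icc 1 (n : ℤ) := hside a Y fun y hy =>
        (Finset.mem_filter.1 (Finset.mem_filter.1 (hY y hy)).1).1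
      set Q := (MvPolynomial.eval a r).natAbs.primeFactors.filter (n < ·) with hQ
      have hQcard : Q.card ≤ r.totalDegree + C₂ :=
        card_primeFactors_gt_le hn2 (Int.natAbs_ne_zero.2 har) (hC₂ n hn a ha)
      have hcover : Y ⊆ Q.biUnion fun p => Y.filter fun y =>
          ∀ f ∈ F, (p : ℤ) ∣ MvPolynomial.eval (Fin.cons y a : Fin (s + 1) → ℤ) f := by
        intro y hy
        obtain ⟨p, hp, hnp, hpf⟩ := (Finset.mem_filter.1 (Finset.mem_filter.1 (hY y hy)).1).2
        refine Finset.mem_biUnion.2 ⟨p, ?_, Finset.mem_filter.2 ⟨hy, hpf⟩⟩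
        refine Finset.mem_filter.2 ⟨Nat.mem_primeFactors.2 ⟨hp, ?_, by simpa using har⟩, hnp⟩
        rw [← Int.natCast_dvd, MvPolynomial.dvd_eval_iff]
        refine aeval_eq_zero_of_C_mem_span hr (y := (y : ZMod p)) fun f hf => ?_
        exact (MvPolynomial.dvd_eval_cons_iff p y a f).1 (hpf f hf)
      refine (Finset.card_le_card hcover).trans
        ((Finset.card_biUnion_le_card_mul _ _ D fun p hp => ?_).trans
          (Nat.mul_le_mul_right D hQcard))
      obtain ⟨hp, hnp⟩ := Finset.mem_filter.1 hp
      have hpp := Nat.prime_of_mem_primeFactors hp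
      have : Fact p.Prime := ⟨hpp⟩
      -- a prime exceeding the side of the box separates its points
      have hinj : Set.InjOn (fun y : ℤ => (y : ZMod p)) (Finset.Icc 1 (n : ℤ)) := by
        intro x hx y hy hxy
        simp only [Finset.coe_Icc, Set.mem_Icc] at hx hy
        have h := (ZMod.intCast_eq_intCast_iff _ _ _).1 hxy
        rw [Int.ModEq, Int.emod_eq_of_lt (by omega) (by omega),
          Int.emod_eq_of_lt (by omega) (by omega)] at h
        exact h
      rw [← Finset.card_image_of_injOn (hinj.mono (Finset.coe_subset.2
        ((Finset.filter_subset _ _).trans hYn)))]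
      refine card_fibre_le (a := fun j => (a j : ZMod p)) (fun hall => haT.1 ?_) fun y hy => ?_
      · refine Finset.mem_filter.2 ⟨ha, p, hpp, hnp, fun c hc => ?_⟩
        rw [MvPolynomial.dvd_eval_iff]
        exact hall c hc
      · obtain ⟨x, hx, rfl⟩ := Finset.mem_image.1 hy
        exact fun f hf =>
          (MvPolynomial.dvd_eval_cons_iff p x a f).1 ((Finset.mem_filter.1 hx).2 f hf)
    rw [← Finset.card_filter_add_card_filter_not (s := Z)
      (fun v => (Fin.tail v : Fin s → ℤ) ∈ T₁ ∪ T₂)]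
    have h3 := hC₁ n hn
    have h4 := card_gridBox_eval_eq_zero_le hr0 n hn
    have h5 := Finset.card_union_le T₁ T₂
    rw [card_gridBox] at h2
    calc _ ≤ n * (n * (T₁.card + T₂.card) + B * n ^ s) := by
          gcongr
          exact h1.trans (Nat.mul_le_mul_left n h5)
      _ = n * (n * T₁.card) + n * (n * T₂.card) + B * n ^ (s + 1) := by ring
      _ ≤ n * (C₁ * n ^ s) + n * (r.totalDegree * n ^ s) + B * n ^ (s + 1) := by gcongr
      _ = (C₁ + r.totalDegree + B) * n ^ (s + 1) := by ring
      _ ≤ _ := Nat.mul_le_mul_right _ (by omega)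

/-! ### Prime factorization of the normalized least common multiple -/

/-- The exponent lost when a product is replaced by a least common multiple: the sum of the
exponents minus their maximum. -/
def excess {m : ℕ} (e : Fin m → ℕ) : ℕ := ∑ i, e i - Finset.univ.sup e

lemma sup_le_sum {m : ℕ} (e : Fin m → ℕ) : Finset.univ.sup e ≤ ∑ i, e i :=
  Finset.sup_le fun i _ => Finset.single_le_sum (fun _ _ => Nat.zero_le _) (Finset.mem_univ i)

lemma excess_eq_zero {m : ℕ} {e : Fin m → ℕ} (h : ∀ i j, i ≠ j → e i ≠ 0 → e j = 0) :
    excess e = 0 := by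
  rw [excess, Nat.sub_eq_zero_iff_le]
  by_cases h0 : ∃ i, e i ≠ 0
  · obtain ⟨i, hi⟩ := h0
    rw [Finset.sum_eq_single i (fun j _ hj => h i j hj.symm hi) (by simp)]
    exact Finset.le_sup (Finset.mem_univ i)
  · push Not at h0
    simp [h0]

/-- The quotient of a product by the least common multiple, when no prime outside `S` divides two of
the factors. -/
lemma prod_eq_lcm_mul_prod_pow_excess {m : ℕ} (y : Fin m → ℕ) (hy : ∀ i, y i ≠ 0)
    (S : Finset Nat.Primes)
    (hS : ∀ p : Nat.Primes, p ∉ S → ∀ i j, i ≠ j → ¬ ((p : ℕ) ∣ y i ∧ (p : ℕ) ∣ y j)) :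
    ∏ i, y i = Finset.univ.lcm y *
      ∏ p ∈ S, (p : ℕ) ^ excess fun i => (y i).factorization (p : ℕ) := by
  have hl : Finset.univ.lcm y ≠ 0 := by
    rw [Ne, Finset.lcm_eq_zero_iff]
    simp [hy]
  have hp : ∏ p ∈ S, (p : ℕ) ^ (excess fun i => (y i).factorization (p : ℕ)) ≠ 0 :=
    Finset.prod_ne_zero_iff.2 fun p _ => pow_ne_zero _ p.2.ne_zero
  refine Nat.eq_of_factorization_eq (Finset.prod_ne_zero_iff.2 fun i _ => hy i)
    (mul_ne_zero hl hp) fun q => ?_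
  by_cases hq : q.Prime
  swap
  · simp [Nat.factorization_eq_zero_of_not_prime, hq]
  obtain ⟨q, rfl⟩ : ∃ q' : Nat.Primes, (q' : ℕ) = q := ⟨⟨q, hq⟩, rfl⟩
  rw [Nat.factorization_mul hl hp, Finsupp.add_apply,
    Nat.factorization_prod fun i _ => hy i, Finset.factorization_lcm fun i _ => hy i,
    Nat.factorization_prod fun p _ => pow_ne_zero _ p.2.ne_zero, Finsupp.finsetSum_apply,
    Finsupp.finsetSum_apply]
  have h1 : ∑ p ∈ S, ((p : ℕ) ^ excess fun i => (y i).factorization (p : ℕ)).factorization q =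
      excess fun i => (y i).factorization q := by
    have hne : ∀ p : Nat.Primes, p ≠ q → (q : ℕ) ≠ p := fun p h h' => h (Subtype.ext h'.symm)
    by_cases hqS : q ∈ S
    · rw [Finset.sum_eq_single_of_mem q hqS fun p _ hpq => by
        rw [p.2.factorization_pow, Finsupp.single_eq_of_ne (hne p hpq)],
        q.2.factorization_pow, Finsupp.single_eq_same]
    · rw [Finset.sum_eq_zero fun p hpS => by
        rw [p.2.factorization_pow,
          Finsupp.single_eq_of_ne (hne p fun h => hqS (h ▸ hpS))], excess_eq_zero]
      intro i j hij hi
      by_contra hj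
      exact hS q hqS i j hij ⟨Nat.dvd_of_factorization_pos hi, Nat.dvd_of_factorization_pos hj⟩
  rw [h1, excess, Nat.add_sub_cancel' (sup_le_sum _)]

lemma toNat_emultiplicity_int (p : Nat.Primes) {x : ℤ} (hx : x ≠ 0) :
    (emultiplicity (((p : ℕ) : ℤ)) x).toNat = x.natAbs.factorization (p : ℕ) := by
  have : Fact (p : ℕ).Prime := ⟨p.2⟩
  rw [← Int.emultiplicity_natAbs,
    ← padicValNat_eq_emultiplicity (Int.natAbs_ne_zero.2 hx), Nat.factorization_def _ p.2]
  rfl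

/-- The exponents of the integer values of the `f i` at the prime `p`; the exponent of the value
`0`, which is infinite, is replaced by `0`. -/
noncomputable def intExponent {s m : ℕ} (f : Fin m → MvPolynomial (Fin s) ℤ) (p : Nat.Primes)
    (u : Fin s → ℤ) (i : Fin m) : ℕ :=
  (emultiplicity ((p : ℕ) : ℤ) (MvPolynomial.eval u (f i))).toNat

/-- The contribution of the primes in `S` to the normalized least common multiple of the values of
the `f i`. -/
noncomputable def partialNLCM {s m : ℕ} (f : Fin m → MvPolynomial (Fin s) ℤ)
    (S : Finset Nat.Primes) (u : Fin s → ℤ) : ℝ :=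
  1 / ((∏ p ∈ S, (p : ℕ) ^ excess (intExponent f p u) : ℕ) : ℝ)

lemma intLCM_polyValues {s m : ℕ} (f : Fin m → MvPolynomial (Fin s) ℤ) (u : Fin s → ℤ) :
    intLCM (polyValues f u) = Finset.univ.lcm fun i => (MvPolynomial.eval u (f i)).natAbs := by
  simp [intLCM, polyValues, Finset.lcm_def, Function.comp_def]

lemma intNLCM_eq_div (A : Multiset ℤ) :
    intNLCM A = (intLCM (A.filter (· ≠ 0)) : ℝ) /
      ((A.filter (· ≠ 0)).map fun a : ℤ => |(a : ℝ)|).prod := by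
  -- the definition casts to `ℝ` by coercing the whole multiset through its monad structure
  simp only [intNLCM, Multiset.bind_def, Multiset.pure_def, Multiset.bind_singleton,
    Multiset.map_map, Function.comp_def]

lemma filter_polyValues {s m : ℕ} (f : Fin m → MvPolynomial (Fin s) ℤ) (u : Fin s → ℤ)
    (hu : ∀ i, MvPolynomial.eval u (f i) ≠ 0) :
    (polyValues f u).filter (· ≠ 0) = polyValues f u := by
  rw [Multiset.filter_eq_self]
  simpa [polyValues] using hu

lemma prod_abs_polyValues {s m : ℕ} (f : Fin m → MvPolynomial (Fin s) ℤ) (u : Fin s → ℤ) :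
    ((polyValues f u).map fun a : ℤ => |(a : ℝ)|).prod =
      ∏ i, |((MvPolynomial.eval u (f i) : ℤ) : ℝ)| := by
  simp only [polyValues, Multiset.map_map]
  rfl

/-- If some value is `0`, both sides vanish. -/
lemma intLCM_eq_intNLCM_mul {s m : ℕ} (f : Fin m → MvPolynomial (Fin s) ℤ) (u : Fin s → ℤ) :
    (intLCM (polyValues f u) : ℝ) =
      intNLCM (polyValues f u) * ∏ i, |((MvPolynomial.eval u (f i) : ℤ) : ℝ)| := by
  by_cases hu : ∀ i, MvPolynomial.eval u (f i) ≠ 0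
  · rw [intNLCM_eq_div, filter_polyValues f u hu, prod_abs_polyValues, div_mul_cancel₀]
    exact Finset.prod_ne_zero_iff.2 fun i _ => by simpa using hu i
  · push Not at hu
    obtain ⟨i, hi⟩ := hu
    rw [Finset.prod_eq_zero (Finset.mem_univ i) (by simp [hi]), mul_zero, intLCM_polyValues]
    rw [Nat.cast_eq_zero, Finset.lcm_eq_zero_iff]
    exact ⟨i, by simp, by simp [hi]⟩

lemma intNLCM_eq_partialNLCM {s m : ℕ} (f : Fin m → MvPolynomial (Fin s) ℤ) (u : Fin s → ℤ)
    (hu : ∀ i, MvPolynomial.eval u (f i) ≠ 0) (S : Finset Nat.Primes)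
    (hS : ∀ p : Nat.Primes, p ∉ S → ∀ i j, i ≠ j →
      ¬ (((p : ℕ) : ℤ) ∣ MvPolynomial.eval u (f i) ∧ ((p : ℕ) : ℤ) ∣ MvPolynomial.eval u (f j))) :
    intNLCM (polyValues f u) = partialNLCM f S u := by
  have hy : ∀ i, (MvPolynomial.eval u (f i)).natAbs ≠ 0 := fun i => Int.natAbs_ne_zero.2 (hu i)
  have h := prod_eq_lcm_mul_prod_pow_excess _ hy S fun p hp i j hij => by
    rw [← Int.natCast_dvd, ← Int.natCast_dvd]
    exact hS p hp i j hij
  have hl : Finset.univ.lcm (fun i => (MvPolynomial.eval u (f i)).natAbs) ≠ 0 := by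
    rw [Ne, Finset.lcm_eq_zero_iff]
    simpa using hu
  have h2 : ∏ i, |((MvPolynomial.eval u (f i) : ℤ) : ℝ)| =
      ((∏ i, (MvPolynomial.eval u (f i)).natAbs : ℕ) : ℝ) := by
    rw [Nat.cast_prod]
    exact Finset.prod_congr rfl fun i _ => by simp
  have h3 : (fun p : Nat.Primes => excess (intExponent f p u)) = fun p : Nat.Primes =>
      excess fun i => ((MvPolynomial.eval u (f i)).natAbs).factorization (p : ℕ) := by
    funext p
    congr 1
    funext i
    exact toNat_emultiplicity_int p (hu i)
  rw [intNLCM_eq_div, filter_polyValues f u hu, prod_abs_polyValues, intLCM_polyValues, h2, h,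
    partialNLCM, Nat.cast_mul, div_mul_eq_div_div, div_self (by exact_mod_cast hl)]
  simp only [congrFun h3]

lemma emultiplicity_congr {α β : Type*} [Monoid α] [Monoid β] {a x : α} {b y : β} {K : ℕ}
    (h : ∀ k ≤ K, a ^ k ∣ x ↔ b ^ k ∣ y) (hK : ¬ a ^ K ∣ x) :
    emultiplicity a x = emultiplicity b y := by
  refine emultiplicity_eq_emultiplicity_iff.2 fun k => ?_
  rcases le_total k K with hk | hk
  · exact h k hk
  · exact iff_of_false (fun hx => hK ((pow_dvd_pow a hk).trans hx))
      fun hy => hK ((h K le_rfl).2 ((pow_dvd_pow b hk).trans hy))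

lemma pow_dvd_of_toNat_emultiplicity_ne_zero {α : Type*} [Monoid α] {a x : α}
    (h : (emultiplicity a x).toNat ≠ 0) : a ∣ x := by
  by_contra hx
  exact h (by rw [emultiplicity_eq_zero.2 hx]; rfl)

/-! ### Equidistribution of box points in residue classes -/

/-- The average of `g` over the integer points of the box `{1, …, n} ^ s`. -/
noncomputable def boxAverage (s n : ℕ) (g : (Fin s → ℤ) → ℝ) : ℝ :=
  (∑ u ∈ gridBox s n, g u) / (n : ℝ) ^ s

lemma intCast_le_of_mem_gridBox {s n : ℕ} {u : Fin s → ℤ} (hu : u ∈ gridBox s n) (j : Fin s) :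
    (u j : ℝ) ≤ n := by
  have h : (u j : ℝ) ≤ ((n : ℤ) : ℝ) := Int.cast_le.2 (mem_gridBox.1 hu j).2
  simpa using h

lemma abs_boxAverage_sub_le {s n : ℕ} (hn : 0 < n) {g g' : (Fin s → ℤ) → ℝ} {ε : ℝ}
    (h : ∀ u ∈ gridBox s n, |g u - g' u| ≤ ε) :
    |boxAverage s n g - boxAverage s n g'| ≤ ε := by
  have hn' : (0 : ℝ) < (n : ℝ) ^ s := by positivity
  rw [boxAverage, boxAverage, ← sub_div, ← Finset.sum_sub_distrib, abs_div, abs_of_pos hn',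
    div_le_iff₀ hn']
  refine (Finset.abs_sum_le_sum_abs _ _).trans ((Finset.sum_le_sum h).trans_eq ?_)
  rw [Finset.sum_const, card_gridBox, nsmul_eq_mul, mul_comm]
  push_cast
  ring

open scoped Pointwise in
/-- Convergence of Riemann sums, from the general statement on lattice points in dilated bounded
sets whose frontier is a null set. -/
lemma tendsto_boxAverage_of_continuous {s : ℕ} {ψ : (Fin s → ℝ) → ℝ} (hψ : Continuous ψ) :
    Tendsto (fun n : ℕ => boxAverage s n fun u => ψ fun j => (u j : ℝ) / n) atTop
      (𝓝 (∫ x in Set.Icc 0 1, ψ x)) := by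
  set B : Set (Fin s → ℝ) := Set.univ.pi fun _ => Set.Ioc 0 1 with hB
  have hBae : ∫ x in Set.Icc 0 1, ψ x = ∫ x in B, ψ x :=
    setIntegral_congr_set (Measure.univ_pi_Ioc_ae_eq_Icc (f := fun _ => 0) (g := fun _ => 1)).symm
  have hBb : Bornology.IsBounded B := by
    refine (Metric.isBounded_Icc (0 : Fin s → ℝ) 1).subset fun x hx => ?_
    rw [hB, Set.mem_univ_pi] at hx
    exact ⟨fun j => (hx j).1.le, fun j => (hx j).2⟩
  have hBm : MeasurableSet B := MeasurableSet.univ_pi fun _ => measurableSet_Ioc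
  have hBf : volume (frontier B) = 0 :=
    (convex_pi fun _ _ => convex_Ioc 0 1).addHaar_frontier volume
  have h := tendsto_tsum_div_pow_atTop_integral B ψ hψ hBb hBm hBf
  rw [hBae]
  refine h.congr' ?_
  filter_upwards [eventually_gt_atTop 0] with n hn
  have hn' : (0 : ℝ) < n := by exact_mod_cast hn
  rw [boxAverage, Fintype.card_fin]
  congr 1
  set L : Submodule ℤ (Fin s → ℝ) := Submodule.span ℤ (Set.range (Pi.basisFun ℝ (Fin s)))
  have himg : B ∩ (n : ℝ)⁻¹ • (L : Set (Fin s → ℝ)) =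
      (((gridBox s n).image fun u j => (u j : ℝ) / n : Finset _) : Set (Fin s → ℝ)) := by
    ext x
    rw [Set.mem_inter_iff, Set.mem_inv_smul_set_iff₀ hn'.ne', SetLike.mem_coe,
      Module.Basis.mem_span_iff_repr_mem, hB, Set.mem_univ_pi]
    simp only [Pi.basisFun_repr, Pi.smul_apply, smul_eq_mul, algebraMap_int_eq, Set.mem_range,
      eq_intCast, Finset.coe_image, Set.mem_image, Finset.mem_coe, mem_gridBox, Set.mem_Ioc]
    constructor
    · rintro ⟨hx, hu⟩
      choose u hu using hu
      refine ⟨u, fun j => ?_, funext fun j => by rw [hu, mul_div_cancel_left₀ _ hn'.ne']⟩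
      have h1 : (0 : ℝ) < u j := by rw [hu]; exact mul_pos hn' (hx j).1
      have h2 : (u j : ℝ) ≤ (n : ℤ) := by
        rw [hu]
        push_cast
        exact mul_le_of_le_one_right hn'.le (hx j).2
      exact ⟨by exact_mod_cast h1, by exact_mod_cast h2⟩
    · rintro ⟨u, hu, rfl⟩
      refine ⟨fun j => ?_, fun j => ⟨u j, by field_simp⟩⟩
      have h1 : (0 : ℝ) < u j := by exact_mod_cast (hu j).1
      have h2 : (u j : ℝ) ≤ n := by exact_mod_cast (hu j).2
      exact ⟨by positivity, (div_le_one hn').2 h2⟩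
  rw [tsum_congr_set_coe ψ himg, Finset.tsum_subtype' _ ψ, Finset.sum_image]
  intro u _ v _ huv
  funext j
  have := congrFun huv j
  simp only [div_left_inj' hn'.ne'] at this
  exact_mod_cast this

lemma tendsto_boxAverage_of_uniform {s : ℕ} {ψ : (Fin s → ℝ) → ℝ} (hψ : Continuous ψ)
    {q : ℕ → ℕ} (hq : Tendsto q atTop atTop) {g : ℕ → (Fin s → ℤ) → ℝ}
    (hg : ∀ ε > 0, ∀ᶠ n in atTop, ∀ u ∈ gridBox s (q n),
      |g n u - ψ fun j => (u j : ℝ) / q n| ≤ ε) :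
    Tendsto (fun n : ℕ => boxAverage s (q n) (g n)) atTop (𝓝 (∫ x in Set.Icc 0 1, ψ x)) := by
  have h1 := (tendsto_boxAverage_of_continuous hψ).comp hq
  refine h1.congr_dist ?_
  rw [Metric.tendsto_atTop']
  intro ε hε
  obtain ⟨N, hN⟩ := eventually_atTop.1 ((hg (ε / 2) (by positivity)).and
    (hq.eventually (eventually_gt_atTop 0)))
  refine ⟨N, fun n hn => ?_⟩
  obtain ⟨h2, h3⟩ := hN n hn.le
  rw [Real.dist_eq, sub_zero, abs_of_nonneg dist_nonneg, dist_comm, Real.dist_eq]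
  exact (abs_boxAverage_sub_le h3 h2).trans_lt (by linarith)

/-- When the side of the box is a multiple of `M`, a residue class modulo `M` meets the box in an
affine copy of a box with side smaller by the factor `M`. -/
lemma sum_gridBox_residueClass {s M : ℕ} (hM : 0 < M) (a : Fin s → ZMod M) :
    ∃ b : Fin s → ℤ, (∀ j, 0 ≤ b j ∧ b j < M) ∧ ∀ (q : ℕ) (g : (Fin s → ℤ) → ℝ),
      ∑ u ∈ (gridBox s (M * q)).filter (fun u => (fun j => (u j : ZMod M)) = a), g u =
        ∑ v ∈ gridBox s q, g fun j => M * v j - b j := by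
  have : NeZero M := ⟨hM.ne'⟩
  refine ⟨fun j => ((-a j).val : ℤ), fun j => ⟨by positivity, by
    beta_reduce
    exact_mod_cast ZMod.val_lt (-a j)⟩, fun q g => ?_⟩
  have hM' : (0 : ℤ) < M := by exact_mod_cast hM
  have hb : ∀ j, (((-a j).val : ℕ) : ZMod M) = - a j := fun j => ZMod.natCast_zmod_val _
  symm
  refine Finset.sum_bij (fun v _ j => M * v j - (-a j).val) (fun v hv => ?_)
    (fun v _ w _ hvw => ?_) (fun u hu => ?_) fun _ _ => rfl
  · rw [Finset.mem_filter, mem_gridBox]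
    refine ⟨fun j => ?_, ?_⟩
    · have h1 := mem_gridBox.1 hv j
      have h2 : ((-a j).val : ℤ) < M := by exact_mod_cast ZMod.val_lt _
      push_cast
      constructor <;> nlinarith
    · funext j
      push_cast
      simp [hb]
  · funext j
    have : (M : ℤ) * v j - (-a j).val = M * w j - (-a j).val := congrFun hvw j
    exact mul_left_cancel₀ hM'.ne' (by linarith)
  · rw [Finset.mem_filter, mem_gridBox] at hu
    have hdvd : ∀ j, (M : ℤ) ∣ u j + (-a j).val := fun j => by
      rw [← ZMod.intCast_zmod_eq_zero_iff_dvd]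
      push_cast
      rw [hb, ← congrFun hu.2 j]
      simp
    choose v hv using hdvd
    refine ⟨v, mem_gridBox.2 fun j => ?_, funext fun j => by rw [← hv]; ring⟩
    have h1 := hu.1 j
    have h2 : ((-a j).val : ℤ) < M := by exact_mod_cast ZMod.val_lt _
    have h3 : (0 : ℤ) ≤ (-a j).val := by positivity
    have h4 := hv j
    push_cast at h1
    constructor
    · by_contra! hlt
      nlinarith
    · by_contra! hlt
      nlinarith

/-- Equidistribution: the points of a residue class, rescaled to the unit cube, become uniformly
distributed, and every class modulo `M` receives the proportion `M ^ (-s)`. -/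
lemma tendsto_boxAverage_residueClass {s M : ℕ} (hM : 0 < M) (a : Fin s → ZMod M)
    {ψ : (Fin s → ℝ) → ℝ} (hψ : Continuous ψ) {g : ℕ → (Fin s → ℤ) → ℝ} {B : ℝ}
    (hB : ∀ n u, |g n u| ≤ B)
    (hg : ∀ ε > 0, ∀ᶠ n in atTop, ∀ u ∈ gridBox s n,
      |g n u - ψ fun j => (u j : ℝ) / n| ≤ ε) :
    Tendsto (fun n : ℕ => boxAverage s n fun u =>
        if (fun j => (u j : ZMod M)) = a then g n u else 0) atTop
      (𝓝 (((M : ℝ) ^ s)⁻¹ * ∫ x in Set.Icc 0 1, ψ x)) := by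
  obtain ⟨b, hb, hsum⟩ := sum_gridBox_residueClass hM a
  have hMR : (0 : ℝ) < M := by exact_mod_cast hM
  have hq : Tendsto (fun n : ℕ => n / M) atTop atTop := Nat.tendsto_div_const_atTop hM.ne'
  -- the proportion of the box covered by its largest sub-box with side a multiple of `M`
  have hratio : Tendsto (fun n : ℕ => ((n / M : ℕ) : ℝ) / n) atTop (𝓝 (M : ℝ)⁻¹) := by
    have h := (tendsto_nat_floor_mul_div_atTop (R := ℝ) (a := (M : ℝ)⁻¹) (by positivity)).comp
      tendsto_natCast_atTop_atTop
    refine h.congr fun n => ?_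
    rw [Function.comp_apply, inv_mul_eq_div, Nat.floor_div_natCast, Nat.floor_natCast]
  have hsub : ∀ n : ℕ, gridBox s (M * (n / M)) ⊆ gridBox s n := fun n u hu =>
    mem_gridBox.2 fun j => ⟨(mem_gridBox.1 hu j).1, (mem_gridBox.1 hu j).2.trans (by
      exact_mod_cast Nat.mul_div_le n M)⟩
  have hmain : Tendsto (fun n : ℕ => boxAverage s (n / M) fun v => g n fun j => M * v j - b j)
      atTop (𝓝 (∫ x in Set.Icc 0 1, ψ x)) := by
    refine tendsto_boxAverage_of_uniform hψ hq fun ε hε => ?_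
    have huc := (isCompact_Icc (a := (0 : Fin s → ℝ)) (b := 1)).uniformContinuousOn_of_continuous
      hψ.continuousOn
    obtain ⟨δ, hδ, hδψ⟩ := Metric.uniformContinuousOn_iff.1 huc (ε / 2) (by positivity)
    have hlarge : ∀ᶠ n : ℕ in atTop, 2 * (M : ℝ) / δ < n :=
      tendsto_natCast_atTop_atTop.eventually (eventually_gt_atTop _)
    filter_upwards [hg (ε / 2) (by positivity), hlarge, eventually_ge_atTop M]
      with n hgn hnδ hnM v hv
    have hn : 0 < n := hM.trans_le hnM
    have hn' : (0 : ℝ) < n := by exact_mod_cast hn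
    have hq0 : (0 : ℝ) < (n / M : ℕ) := by exact_mod_cast Nat.div_pos hnM hM
    have hnq1 : (M : ℝ) * (n / M : ℕ) ≤ n := by exact_mod_cast Nat.mul_div_le n M
    have hnq2 : (n : ℝ) ≤ M * (n / M : ℕ) + M := by
      have := Nat.lt_mul_div_succ n hM
      exact_mod_cast this.le
    have hu : (fun j => M * v j - b j) ∈ gridBox s n := mem_gridBox.2 fun j => by
      have h1 := mem_gridBox.1 hv j
      have h2 := hb j
      have h3 : (M : ℤ) * ((n / M : ℕ) : ℤ) ≤ n := by exact_mod_cast Nat.mul_div_le n M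
      have h4 : (0 : ℤ) < M := by exact_mod_cast hM
      constructor <;> nlinarith
    have hcube : ∀ (k : ℕ) (w : Fin s → ℤ), w ∈ gridBox s k → (fun j => (w j : ℝ) / k) ∈
        Set.Icc (0 : Fin s → ℝ) 1 := fun k w hw => by
      refine ⟨fun j => ?_, fun j => ?_⟩
      · have : (0 : ℝ) ≤ w j := by exact_mod_cast zero_le_one.trans (mem_gridBox.1 hw j).1
        exact div_nonneg this (Nat.cast_nonneg _)
      · exact div_le_one_of_le₀ (intCast_le_of_mem_gridBox hw j) (Nat.cast_nonneg _)
    have hclose : dist (fun j => (((M * v j - b j : ℤ)) : ℝ) / n)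
        (fun j => (v j : ℝ) / (n / M : ℕ)) < δ := by
      rw [dist_pi_lt_iff hδ]
      intro j
      have h1 : (1 : ℝ) ≤ v j := by exact_mod_cast (mem_gridBox.1 hv j).1
      have h2 : (v j : ℝ) ≤ (n / M : ℕ) := intCast_le_of_mem_gridBox hv j
      have h3 : (0 : ℝ) ≤ b j := by exact_mod_cast (hb j).1
      have h4 : (b j : ℝ) ≤ M := by exact_mod_cast (hb j).2.le
      have h5 : 2 * (M : ℝ) / n < δ := by
        rw [div_lt_iff₀ hδ] at hnδ
        rw [div_lt_iff₀ hn']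
        linarith
      refine lt_of_le_of_lt ?_ h5
      set Q : ℝ := ((n / M : ℕ) : ℝ)
      have h6 : (((M * v j - b j : ℤ)) : ℝ) / n - v j / Q =
          -(v j / Q * (n - M * Q) + b j) / n := by
        push_cast
        field_simp
        ring
      have h7 : (v j : ℝ) / Q ≤ 1 := div_le_one_of_le₀ h2 hq0.le
      have h8 : 0 ≤ (v j : ℝ) / Q := by positivity
      rw [Real.dist_eq, h6, abs_div, abs_neg, abs_of_pos hn']
      gcongr
      rw [abs_of_nonneg (by nlinarith)]
      nlinarith
    have h1 := hgn _ hu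
    have h2 := hδψ _ (hcube n _ hu) _ (hcube _ _ hv) hclose
    rw [Real.dist_eq] at h2
    calc _ ≤ _ := abs_sub_le _ (ψ fun j => (((M * v j - b j : ℤ)) : ℝ) / n) _
      _ ≤ ε / 2 + ε / 2 := add_le_add h1 h2.le
      _ = ε := by ring
  have hrest : Tendsto (fun n : ℕ => B * (1 - (M : ℝ) ^ s * (((n / M : ℕ) : ℝ) / n) ^ s)) atTop
      (𝓝 0) := by
    have h := ((hratio.pow s).const_mul ((M : ℝ) ^ s)).const_sub 1 |>.const_mul B
    have e : (M : ℝ) ^ s * (M : ℝ)⁻¹ ^ s = 1 := by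
      rw [← mul_pow, mul_inv_cancel₀ hMR.ne', one_pow]
    rwa [e, sub_self, mul_zero] at h
  have hlim := (hratio.pow s).mul hmain
  rw [inv_pow] at hlim
  refine hlim.congr_dist (squeeze_zero' (Eventually.of_forall fun _ => dist_nonneg) ?_ hrest)
  filter_upwards [eventually_ge_atTop M] with n hnM
  have hn : 0 < n := hM.trans_le hnM
  have hn' : (0 : ℝ) < (n : ℝ) ^ s := by positivity
  have hq0 : (0 : ℝ) < ((n / M : ℕ) : ℝ) ^ s := by
    have : (0 : ℝ) < (n / M : ℕ) := by exact_mod_cast Nat.div_pos hnM hM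
    positivity
  have h1 : ((((n / M : ℕ) : ℝ) / n) ^ s * boxAverage s (n / M) fun v => g n fun j => M * v j - b j)
      = (∑ u ∈ gridBox s (M * (n / M)), if (fun j => (u j : ZMod M)) = a then g n u else 0) /
        (n : ℝ) ^ s := by
    rw [← Finset.sum_filter, hsum, boxAverage, div_pow]
    field_simp
  have h2 : (boxAverage s n fun u => if (fun j => (u j : ZMod M)) = a then g n u else 0) =
      (∑ u ∈ gridBox s n \ gridBox s (M * (n / M)),
        if (fun j => (u j : ZMod M)) = a then g n u else 0) / (n : ℝ) ^ s +
      (∑ u ∈ gridBox s (M * (n / M)), if (fun j => (u j : ZMod M)) = a then g n u else 0) /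
        (n : ℝ) ^ s := by
    rw [boxAverage, ← Finset.sum_sdiff (hsub n), add_div]
  have h3 : ∀ u, |if (fun j => (u j : ZMod M)) = a then g n u else 0| ≤ B := fun u => by
    split_ifs
    · exact hB n u
    · simpa using (abs_nonneg _).trans (hB n u)
  rw [dist_comm, Real.dist_eq, h1, h2, add_sub_cancel_right, abs_div, abs_of_pos hn',
    div_le_iff₀ hn']
  refine (Finset.abs_sum_le_sum_abs _ _).trans ((Finset.sum_le_sum fun u _ => h3 u).trans_eq ?_)
  rw [Finset.sum_const, nsmul_eq_mul, Finset.cast_card_sdiff (hsub n), card_gridBox, card_gridBox]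
  push_cast
  rw [div_pow, mul_pow]
  field_simp

/-! ### Reduction of integer adeles and the Haar measure -/

/-- The modulus `∏ p ∈ S, p ^ K`. -/
def adeleModulus (S : Finset Nat.Primes) (K : ℕ) : ℕ := ∏ p : S, ((p : Nat.Primes) : ℕ) ^ K

lemma adeleModulus_pos (S : Finset Nat.Primes) (K : ℕ) : 0 < adeleModulus S K :=
  Finset.prod_pos fun p _ => pow_pos p.1.2.pos K

lemma pow_dvd_adeleModulus {S : Finset Nat.Primes} {p : Nat.Primes} (hp : p ∈ S) (K : ℕ) :
    (p : ℕ) ^ K ∣ adeleModulus S K :=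
  Finset.dvd_prod_of_mem (fun p : S => ((p : Nat.Primes) : ℕ) ^ K) (Finset.mem_univ ⟨p, hp⟩)

open scoped Function in
lemma pairwise_coprime_pow (S : Finset Nat.Primes) (K : ℕ) :
    Pairwise (Nat.Coprime on fun p : S => ((p : Nat.Primes) : ℕ) ^ K) := fun p q hpq =>
  Nat.Coprime.pow _ _ ((Nat.coprime_primes p.1.2 q.1.2).2 fun h =>
    hpq (Subtype.ext (Subtype.ext h)))

/-- Reduction of integer adeles modulo `adeleModulus S K`, by the Chinese remainder theorem. -/
noncomputable def adeleReduction (S : Finset Nat.Primes) (K : ℕ) :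
    IntegerAdeles →+* ZMod (adeleModulus S K) :=
  (ZMod.prodEquivPi _ (pairwise_coprime_pow S K)).symm.toRingHom.comp
    (RingHom.pi fun p : S => (PadicInt.toZModPow K).comp
      (Pi.evalRingHom (fun p : Nat.Primes => ℤ_[(p : ℕ)]) p.1))

lemma adeleReduction_eq_intCast_iff (S : Finset Nat.Primes) (K : ℕ) (x : IntegerAdeles) (z : ℤ) :
    adeleReduction S K x = z ↔ ∀ p ∈ S, ((p : ℕ) : ℤ_[(p : ℕ)]) ^ K ∣ x p - z := by
  have h0 : adeleReduction S K x = z ↔ adeleReduction S K (x - z) = 0 := by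
    rw [map_sub, map_intCast, sub_eq_zero]
  rw [h0]
  change (ZMod.prodEquivPi _ (pairwise_coprime_pow S K)).symm
    (fun p : S => PadicInt.toZModPow K ((x - z) p.1)) = 0 ↔ _
  rw [EmbeddingLike.map_eq_zero_iff, funext_iff, Subtype.forall]
  refine forall₂_congr fun p hp => ?_
  rw [← Ideal.mem_span_singleton, ← PadicInt.ker_toZModPow, RingHom.mem_ker]
  rfl

/-- Divisibility by the prime powers in the modulus can be read off from the reduction. -/
lemma pow_dvd_iff_of_adeleReduction_eq {S : Finset Nat.Primes} {K : ℕ} {x : IntegerAdeles} {z : ℤ}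
    (h : adeleReduction S K x = z) {p : Nat.Primes} (hp : p ∈ S) {k : ℕ} (hk : k ≤ K) :
    ((p : ℕ) : ℤ_[(p : ℕ)]) ^ k ∣ x p ↔ (((p : ℕ) : ℤ)) ^ k ∣ z := by
  have h1 := (pow_dvd_pow _ hk).trans ((adeleReduction_eq_intCast_iff S K x z).1 h p hp)
  rw [dvd_iff_dvd_of_dvd_sub h1, PadicInt.pow_p_dvd_int_iff]

lemma pow_dvd_iff_of_intCast_eq {S : Finset Nat.Primes} {K : ℕ} {y z : ℤ}
    (h : (y : ZMod (adeleModulus S K)) = z) {p : Nat.Primes} (hp : p ∈ S) {k : ℕ} (hk : k ≤ K) :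
    (((p : ℕ) : ℤ)) ^ k ∣ y ↔ (((p : ℕ) : ℤ)) ^ k ∣ z := by
  have h1 : ((adeleModulus S K : ℕ) : ℤ) ∣ y - z := by
    rw [← ZMod.intCast_zmod_eq_zero_iff_dvd]
    push_cast
    rw [h, sub_self]
  have h2 : (((p : ℕ) : ℤ)) ^ k ∣ (adeleModulus S K : ℕ) := by
    exact_mod_cast (pow_dvd_pow _ hk).trans (pow_dvd_adeleModulus hp K)
  exact dvd_iff_dvd_of_dvd_sub (h2.trans h1)

lemma PadicInt.measurableSet_pow_dvd (p : ℕ) [Fact p.Prime] (k : ℕ) (z : ℤ_[p]) :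
    MeasurableSet {x : ℤ_[p] | (p : ℤ_[p]) ^ k ∣ x - z} := by
  have : {x : ℤ_[p] | (p : ℤ_[p]) ^ k ∣ x - z} =
      {x : ℤ_[p] | ‖x - z‖ ≤ (p : ℝ) ^ (-k : ℤ)} := by
    ext x
    simp only [Set.mem_ofPred_eq]
    rw [PadicInt.norm_le_pow_iff_mem_span_pow, Ideal.mem_span_singleton]
  rw [this]
  exact (isClosed_le (by fun_prop) continuous_const).measurableSet

lemma measurable_adeleReduction (S : Finset Nat.Primes) (K : ℕ) :
    Measurable (adeleReduction S K) := by
  have : NeZero (adeleModulus S K) := ⟨(adeleModulus_pos S K).ne'⟩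
  refine measurable_to_countable' fun a => ?_
  obtain ⟨z, rfl⟩ := ZMod.intCast_surjective a
  have : adeleReduction S K ⁻¹' {(z : ZMod (adeleModulus S K))} =
      ⋂ p ∈ S, (fun x : IntegerAdeles => x p) ⁻¹'
        {y : ℤ_[(p : ℕ)] | ((p : ℕ) : ℤ_[(p : ℕ)]) ^ K ∣ y - z} := by
    ext x
    simp [adeleReduction_eq_intCast_iff]
  rw [this]
  exact Finset.measurableSet_biInter _ fun p _ =>
    measurable_pi_apply p (PadicInt.measurableSet_pow_dvd _ _ _)

instance adelesHaar.instIsProbabilityMeasure : IsProbabilityMeasure adelesHaar := by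
  unfold adelesHaar
  infer_instance

lemma map_add_right_adelesHaar (c : IntegerAdeles) :
    adelesHaar.map (fun x => x + c) = adelesHaar := by
  have h := Measure.infinitePi_map_pi (μ := fun p : Nat.Primes => padicHaar (p : ℕ))
    (f := fun p x => x + c p) fun p => measurable_add_const _
  have h2 : ∀ p : Nat.Primes, (padicHaar (p : ℕ)).map (fun x => x + c p) = padicHaar (p : ℕ) :=
    fun p => by
      unfold padicHaar
      exact map_add_right_eq_self _ _
  simp only [h2] at h
  exact h

/-- A Haar distributed integer adele is uniformly distributed modulo every modulus: its law is
invariant under translation by integers, which act transitively on the residue classes. -/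
lemma adelesHaar_preimage_adeleReduction (S : Finset Nat.Primes) (K : ℕ)
    (a : ZMod (adeleModulus S K)) :
    adelesHaar (adeleReduction S K ⁻¹' {a}) = (adeleModulus S K : ENNReal)⁻¹ := by
  have hM := adeleModulus_pos S K
  have : NeZero (adeleModulus S K) := ⟨hM.ne'⟩
  have hmeas : ∀ b, MeasurableSet (adeleReduction S K ⁻¹' {b}) := fun b =>
    measurable_adeleReduction S K (measurableSet_singleton b)
  have hconst : ∀ b, adelesHaar (adeleReduction S K ⁻¹' {b}) =
      adelesHaar (adeleReduction S K ⁻¹' {a}) := by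
    intro b
    obtain ⟨z, hz⟩ := ZMod.intCast_surjective (b - a)
    rw [← map_add_right_adelesHaar (z : IntegerAdeles), Measure.map_apply
      (measurable_add_const _) (hmeas b), map_add_right_adelesHaar]
    congr 1
    ext x
    simp only [Set.mem_preimage, Set.mem_singleton_iff, map_add, map_intCast, hz]
    rw [add_sub, add_comm, ← sub_eq_zero, add_sub_assoc, add_sub_cancel_left, sub_eq_zero]
  have hsum : ∑ b : ZMod (adeleModulus S K), adelesHaar (adeleReduction S K ⁻¹' {b}) = 1 := by
    rw [← measure_biUnion_finset (fun b _ c _ hbc =>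
      Disjoint.preimage _ (Set.disjoint_singleton.2 hbc)) fun b _ => hmeas b]
    have : ⋃ b ∈ (Finset.univ : Finset (ZMod (adeleModulus S K))),
        adeleReduction S K ⁻¹' {b} = Set.univ := by
      ext x
      simp
    rw [this, measure_univ]
  simp only [hconst, Finset.sum_const, Finset.card_univ, ZMod.card, nsmul_eq_mul] at hsum
  exact ENNReal.eq_inv_of_mul_eq_one_left (by rwa [mul_comm])

instance PadicInt.nhdsNE_neBot (p : ℕ) [Fact p.Prime] : (𝓝[≠] (0 : ℤ_[p])).NeBot := by
  refine mem_closure_iff_nhdsWithin_neBot.1 (Metric.mem_closure_iff.2 fun ε hε => ?_)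
  obtain ⟨k, hk⟩ := PadicInt.exists_pow_neg_lt p hε
  refine ⟨(p : ℤ_[p]) ^ k, pow_ne_zero _ PadicInt.prime_p.ne_zero, ?_⟩
  rwa [dist_zero_left, PadicInt.norm_p_pow]

instance padicHaar.instNullSingletonClass (p : ℕ) [Fact p.Prime] :
    NullSingletonClass (padicHaar p) := by
  unfold padicHaar
  infer_instance

lemma MvPolynomial.continuous_aeval_int {A : Type*} [CommRing A] [TopologicalSpace A]
    [IsTopologicalRing A] {s : ℕ} (f : MvPolynomial (Fin s) ℤ) :
    Continuous fun x : Fin s → A => MvPolynomial.aeval x f := by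
  have : (fun x : Fin s → A => MvPolynomial.aeval x f) =
      fun x => MvPolynomial.eval x (MvPolynomial.map (Int.castRingHom A) f) := by
    funext x
    rw [MvPolynomial.eval_map, MvPolynomial.aeval_def, algebraMap_int_eq]
  rw [this]
  exact MvPolynomial.continuous_eval _

/-- The zero set of a non-zero integer polynomial is a null set for the Haar measure on
`p`-adic points: above almost every point the leading coefficient does not vanish, so the fibre is
finite. -/
lemma ae_aeval_ne_zero (p : ℕ) [Fact p.Prime] {s : ℕ} {f : MvPolynomial (Fin s) ℤ} (hf : f ≠ 0) :
    ∀ᵐ x ∂(Measure.pi fun _ : Fin s => padicHaar p), MvPolynomial.aeval x f ≠ 0 := by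
  classical
  induction s with
  | zero =>
    obtain ⟨c, rfl⟩ := MvPolynomial.C_surjective (Fin 0) f
    have hc : c ≠ 0 := by simpa using hf
    exact Eventually.of_forall fun x => by simpa using hc
  | succ s ih =>
    set P := MvPolynomial.finSuccEquiv ℤ s f with hP
    have hP0 : P.leadingCoeff ≠ 0 := by
      rw [Ne, Polynomial.leadingCoeff_eq_zero, hP]
      simpa using hf
    have hmp := (measurePreserving_piFinSuccAbove (fun _ : Fin (s + 1) => padicHaar p) 0).symm
    have hmeas : MeasurableSet {x : Fin (s + 1) → ℤ_[p] | MvPolynomial.aeval x f = 0} :=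
      (isClosed_eq (MvPolynomial.continuous_aeval_int f) continuous_const).measurableSet
    rw [ae_iff]
    simp only [not_not]
    rw [← hmp.measure_preimage hmeas.nullMeasurableSet,
      Measure.prod_apply_symm (hmp.measurable hmeas)]
    refine lintegral_eq_zero_of_ae_eq_zero ?_
    filter_upwards [ih hP0] with a ha
    set φ := (MvPolynomial.aeval a : MvPolynomial (Fin s) ℤ →ₐ[ℤ] ℤ_[p]).toRingHom
    have hPa : P.map φ ≠ 0 := fun h => ha (by
      have : (P.map φ).coeff P.natDegree = 0 := by rw [h, Polynomial.coeff_zero]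
      rwa [Polynomial.coeff_map] at this)
    refine (((P.map φ).roots.toFinset.finite_toSet).subset fun y hy => ?_).measure_zero _
    have hy' : MvPolynomial.aeval (Fin.insertNth 0 y a : Fin (s + 1) → ℤ_[p]) f = 0 := hy
    rw [Fin.insertNth_zero', MvPolynomial.aeval_cons, ← hP] at hy'
    rw [Finset.mem_coe, Multiset.mem_toFinset, Polynomial.mem_roots hPa, Polynomial.IsRoot,
      Polynomial.eval_map]
    exact hy'

/-! ### Primes dividing two values at integer points -/

lemma noCommonFactor_pair {s m : ℕ} {f : Fin m → MvPolynomial (Fin s) ℤ} (hf : ∀ i, f i ≠ 0)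
    (hfactor : ∀ i j, i ≠ j → ∀ h : MvPolynomial (Fin s) ℤ, h ∣ f i → h ∣ f j →
      h.totalDegree = 0) {i j : Fin m} (hij : i ≠ j) :
    ∃ F : Finset (MvPolynomial (Fin s) ℤ), NoCommonFactor F ∧ ∀ g, g ∈ F ↔ g = f i ∨ g = f j := by
  classical
  refine ⟨{f i, f j}, ⟨⟨f i, by simp, hf i⟩, fun h hh => ?_⟩, fun g => by simp⟩
  exact hfactor i j hij h (hh _ (by simp)) (hh _ (by simp))

/-- The prime `p` divides at least two of the values `f i u`. -/
def DividesTwo {s m : ℕ} (f : Fin m → MvPolynomial (Fin s) ℤ) (p : ℕ) (u : Fin s → ℤ) : Prop :=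
  ∃ i j, i ≠ j ∧ (p : ℤ) ∣ MvPolynomial.eval u (f i) ∧ (p : ℤ) ∣ MvPolynomial.eval u (f j)

/-- Union bound over pairs of indices. -/
lemma card_filter_le_of_exists_pair {α ι : Type*} [Fintype ι] (T : Finset α) (P : α → Prop)
    [DecidablePred P] (Q : ι → ι → α → Prop) [∀ i j, DecidablePred (Q i j)]
    (hPQ : ∀ u, P u → ∃ i j, i ≠ j ∧ Q i j u) (b : ι → ι → ℕ) (N k : ℕ)
    (h : ∀ i j, i ≠ j → k * (T.filter fun u => Q i j u).card ≤ b i j * N) :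
    k * (T.filter fun u => P u).card ≤ (∑ i, ∑ j, b i j) * N := by
  classical
  have h1 : (T.filter fun u => P u) ⊆
      Finset.univ.biUnion fun i => Finset.univ.biUnion fun j =>
        if i ≠ j then T.filter fun u => Q i j u else ∅ := by
    intro u hu
    obtain ⟨hu, hP⟩ := Finset.mem_filter.1 hu
    obtain ⟨i, j, hij, hQ⟩ := hPQ u hP
    simp only [Finset.mem_biUnion, Finset.mem_univ, true_and]
    exact ⟨i, j, by simp [hij, hu, hQ]⟩
  refine (Nat.mul_le_mul_left k (Finset.card_le_card h1)).trans ?_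
  refine (Nat.mul_le_mul_left k (Finset.card_biUnion_le.trans
    (Finset.sum_le_sum fun i _ => Finset.card_biUnion_le))).trans ?_
  simp only [Finset.mul_sum, Finset.sum_mul]
  refine Finset.sum_le_sum fun i _ => Finset.sum_le_sum fun j _ => ?_
  by_cases hij : i = j
  · simp [hij]
  · simpa [hij] using h i j hij

open scoped Classical in
lemma exists_card_dividesTwo_le {s m : ℕ} {f : Fin m → MvPolynomial (Fin s) ℤ}
    (hf : ∀ i, f i ≠ 0)
    (hfactor : ∀ i j, i ≠ j → ∀ h : MvPolynomial (Fin s) ℤ, h ∣ f i → h ∣ f j →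
      h.totalDegree = 0) :
    ∃ C : ℕ, ∀ n p : ℕ, p.Prime → p ≤ n →
      p ^ 2 * ((gridBox s n).filter fun u => DividesTwo f p u).card ≤ C * n ^ s := by
  have h : ∀ i j, ∃ C : ℕ, i ≠ j → ∀ n p : ℕ, p.Prime → p ≤ n →
      p ^ 2 * ((gridBox s n).filter fun u => (p : ℤ) ∣ MvPolynomial.eval u (f i) ∧
        (p : ℤ) ∣ MvPolynomial.eval u (f j)).card ≤ C * n ^ s := by
    intro i j
    by_cases hij : i = j
    · exact ⟨0, fun h => absurd hij h⟩
    obtain ⟨F, hF, hmem⟩ := noCommonFactor_pair hf hfactor hij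
    obtain ⟨C, hC⟩ := exists_card_gridBox_dvd_le hF
    refine ⟨C, fun _ n p hp hpn => ?_⟩
    convert hC n p hp hpn using 4
    simp [hmem]
  choose C hC using h
  refine ⟨∑ i, ∑ j, C i j, fun n p hp hpn => ?_⟩
  exact card_filter_le_of_exists_pair _ (DividesTwo f p) _ (fun u hu => hu) C _ _
    fun i j hij => hC i j hij n p hp hpn

open scoped Classical in
lemma exists_card_dividesTwo_large_le {s m : ℕ} {f : Fin m → MvPolynomial (Fin s) ℤ}
    (hf : ∀ i, f i ≠ 0)
    (hfactor : ∀ i j, i ≠ j → ∀ h : MvPolynomial (Fin s) ℤ, h ∣ f i → h ∣ f j →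
      h.totalDegree = 0) :
    ∃ C : ℕ, ∀ n : ℕ, 0 < n →
      n * ((gridBox s n).filter fun u => ∃ p : ℕ, p.Prime ∧ n < p ∧ DividesTwo f p u).card
        ≤ C * n ^ s := by
  have h : ∀ i j, ∃ C : ℕ, i ≠ j → ∀ n : ℕ, 0 < n →
      n * ((gridBox s n).filter fun u => ∃ p : ℕ, p.Prime ∧ n < p ∧
        ((p : ℤ) ∣ MvPolynomial.eval u (f i) ∧ (p : ℤ) ∣ MvPolynomial.eval u (f j))).card
          ≤ C * n ^ s := by
    intro i j
    by_cases hij : i = j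
    · exact ⟨0, fun h => absurd hij h⟩
    obtain ⟨F, hF, hmem⟩ := noCommonFactor_pair hf hfactor hij
    obtain ⟨C, hC⟩ := exists_card_gridBox_large_prime_le hF
    refine ⟨C, fun _ n hn => ?_⟩
    convert hC n hn using 4
    simp [hmem]
  choose C hC using h
  refine ⟨∑ i, ∑ j, C i j, fun n hn => ?_⟩
  refine card_filter_le_of_exists_pair _ _ _ (fun u hu => ?_) C _ _
    fun i j hij => hC i j hij n hn
  obtain ⟨p, hp, hnp, i, j, hij, h⟩ := hu
  exact ⟨i, j, hij, p, hp, hnp, h⟩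

lemma summable_primes_inv_sq : Summable fun p : Nat.Primes => (((p : ℕ) : ℝ) ^ 2)⁻¹ :=
  (Real.summable_nat_pow_inv.2 one_lt_two).comp_injective
    (i := fun p : Nat.Primes => (p : ℕ)) Subtype.val_injective

/-- The tail of the sum of `p ^ (-2)` over the primes outside `S`. -/
noncomputable def primeTail (S : Finset Nat.Primes) : ℝ :=
  ∑' p : {p : Nat.Primes // p ∉ S}, (((p.1 : ℕ) : ℝ) ^ 2)⁻¹

lemma tendsto_primeTail : Tendsto primeTail atTop (𝓝 0) :=
  tendsto_tsum_compl_atTop_zero fun p : Nat.Primes => (((p : ℕ) : ℝ) ^ 2)⁻¹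

lemma sum_le_primeTail (S T : Finset Nat.Primes) (hST : ∀ p ∈ T, p ∉ S) :
    ∑ p ∈ T, (((p : ℕ) : ℝ) ^ 2)⁻¹ ≤ primeTail S := by
  have hs : Summable fun p : {p : Nat.Primes // p ∉ S} => (((p.1 : ℕ) : ℝ) ^ 2)⁻¹ :=
    summable_primes_inv_sq.comp_injective (i := Subtype.val) Subtype.val_injective
  rw [← Finset.sum_subtype_of_mem (fun p : Nat.Primes => (((p : ℕ) : ℝ) ^ 2)⁻¹) hST]
  exact hs.sum_le_tsum _ fun _ _ => by positivity

open scoped Classical in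
/-- The points of the box at which some prime outside `S` divides two of the values are rare,
uniformly in the size of the box. The primes up to the side contribute a tail of `∑ p ^ (-2)`, the
larger ones `1 / n`. -/
lemma exists_dividesTwo_outside_le {s m : ℕ} {f : Fin m → MvPolynomial (Fin s) ℤ}
    (hf : ∀ i, f i ≠ 0)
    (hfactor : ∀ i j, i ≠ j → ∀ h : MvPolynomial (Fin s) ℤ, h ∣ f i → h ∣ f j →
      h.totalDegree = 0) :
    ∃ C : ℝ, 0 ≤ C ∧ ∀ (S : Finset Nat.Primes) (n : ℕ), 0 < n →
      (((gridBox s n).filter fun u => ∃ p : Nat.Primes, p ∉ S ∧ DividesTwo f p u).card : ℝ) ≤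
        C * (primeTail S + 1 / n) * n ^ s := by
  obtain ⟨C₁, hC₁⟩ := exists_card_dividesTwo_le hf hfactor
  obtain ⟨C₂, hC₂⟩ := exists_card_dividesTwo_large_le hf hfactor
  refine ⟨C₁ + C₂, by positivity, fun S n hn => ?_⟩
  have hfin : {p : Nat.Primes | (p : ℕ) ≤ n}.Finite :=
    (Set.finite_Iic n).preimage (f := fun p : Nat.Primes => (p : ℕ))
      Subtype.val_injective.injOn
  set T := hfin.toFinset.filter (· ∉ S) with hT
  have hTail : ∑ p ∈ T, (((p : ℕ) : ℝ) ^ 2)⁻¹ ≤ primeTail S :=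
    sum_le_primeTail S T fun p hp => (Finset.mem_filter.1 hp).2
  have hTail0 : 0 ≤ primeTail S := (Finset.sum_nonneg fun _ _ => by positivity).trans hTail
  have hsub : ((gridBox s n).filter fun u => ∃ p : Nat.Primes, p ∉ S ∧ DividesTwo f p u) ⊆
      (T.biUnion fun p => (gridBox s n).filter fun u => DividesTwo f p u) ∪
        (gridBox s n).filter fun u => ∃ p : ℕ, p.Prime ∧ n < p ∧ DividesTwo f p u := by
    intro u hu
    obtain ⟨hu, p, hp, hpu⟩ := Finset.mem_filter.1 hu
    rw [Finset.mem_union, Finset.mem_biUnion]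
    rcases le_or_gt (p : ℕ) n with hpn | hpn
    · exact Or.inl ⟨p, Finset.mem_filter.2 ⟨hfin.mem_toFinset.2 hpn, hp⟩,
        Finset.mem_filter.2 ⟨hu, hpu⟩⟩
    · exact Or.inr (Finset.mem_filter.2 ⟨hu, p, p.2, hpn, hpu⟩)
  have hcard := (Finset.card_le_card hsub).trans ((Finset.card_union_le _ _).trans
    (Nat.add_le_add_right Finset.card_biUnion_le _))
  have hn' : (0 : ℝ) < n := by exact_mod_cast hn
  have h1 : ∀ p ∈ T, (((gridBox s n).filter fun u => DividesTwo f p u).card : ℝ) ≤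
      (((p : ℕ) : ℝ) ^ 2)⁻¹ * (C₁ * n ^ s) := by
    intro p hp
    have hp0 : (0 : ℝ) < (p : ℕ) := by exact_mod_cast p.2.pos
    have := hC₁ n p p.2 (hfin.mem_toFinset.1 (Finset.mem_filter.1 hp).1)
    rw [inv_mul_eq_div, le_div_iff₀ (by positivity), mul_comm]
    exact_mod_cast this
  have h2 : (((gridBox s n).filter fun u =>
      ∃ p : ℕ, p.Prime ∧ n < p ∧ DividesTwo f p u).card : ℝ) ≤ (1 / n) * (C₂ * n ^ s) := by
    rw [one_div, inv_mul_eq_div, le_div_iff₀ hn', mul_comm]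
    exact_mod_cast hC₂ n hn
  calc _ ≤ ((∑ p ∈ T, ((gridBox s n).filter fun u => DividesTwo f p u).card +
        ((gridBox s n).filter fun u =>
          ∃ p : ℕ, p.Prime ∧ n < p ∧ DividesTwo f p u).card : ℕ) : ℝ) := Nat.cast_le.2 hcard
    _ ≤ ∑ p ∈ T, (((p : ℕ) : ℝ) ^ 2)⁻¹ * (C₁ * n ^ s) + (1 / n) * (C₂ * n ^ s) := by
      push_cast
      exact add_le_add (Finset.sum_le_sum h1) h2
    _ ≤ primeTail S * (C₁ * n ^ s) + (1 / n) * (C₂ * n ^ s) := by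
      rw [← Finset.sum_mul]
      gcongr
    _ ≤ (primeTail S + 1 / n) * (C₁ * n ^ s) + (primeTail S + 1 / n) * (C₂ * n ^ s) := by
      have : (0 : ℝ) ≤ 1 / n := by positivity
      gcongr <;> linarith
    _ = _ := by ring

/-! ### Periodic approximation of the normalized least common multiple -/

lemma IntegerAdeles.aeval_apply {s : ℕ} (x : Fin s → IntegerAdeles) (f : MvPolynomial (Fin s) ℤ)
    (p : Nat.Primes) :
    (MvPolynomial.aeval x f) p = MvPolynomial.aeval (fun j => x j p) f := by
  induction f using MvPolynomial.induction_on with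
  | C a => simp
  | add g h hg hh => simp [hg, hh]
  | mul_X g i hg => simp [hg]

lemma adeleReduction_aeval {S : Finset Nat.Primes} {K s : ℕ} {x : Fin s → IntegerAdeles}
    {u : Fin s → ℤ} (h : ∀ j, adeleReduction S K (x j) = u j) (f : MvPolynomial (Fin s) ℤ) :
    adeleReduction S K (MvPolynomial.aeval x f) = (MvPolynomial.eval u f : ℤ) := by
  induction f using MvPolynomial.induction_on with
  | C a => simp
  | add g k hg hk => simp [hg, hk]
  | mul_X g i hg => simp [hg, h]

/-- The exponents of the adelic values of the `f i` at the prime `p`, an infinite exponent being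
replaced by `0`. -/
noncomputable def adeleExponent {s m : ℕ} (f : Fin m → MvPolynomial (Fin s) ℤ) (p : Nat.Primes)
    (x : Fin s → IntegerAdeles) (i : Fin m) : ℕ :=
  (primeExponent p (MvPolynomial.aeval x (f i))).toNat

/-- The denominator of the limiting variable: the product over all primes of the excess prime
powers of the adelic values. It is `1` by convention when infinitely many factors are
non-trivial. -/
noncomputable def limitDenominator {s m : ℕ} (f : Fin m → MvPolynomial (Fin s) ℤ)
    (x : Fin s → IntegerAdeles) : ℕ :=
  ∏ᶠ p : Nat.Primes, (p : ℕ) ^ excess (adeleExponent f p x)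

lemma limitDenominator_pos {s m : ℕ} (f : Fin m → MvPolynomial (Fin s) ℤ)
    (x : Fin s → IntegerAdeles) : 0 < limitDenominator f x := by
  refine finprod_induction (fun k => 0 < k) Nat.one_pos (fun _ _ => Nat.mul_pos) fun p => ?_
  exact pow_pos p.2.pos _

/-- The prime `p` divides at least two of the adelic values of the `f i`. -/
def AdeleDividesTwo {s m : ℕ} (f : Fin m → MvPolynomial (Fin s) ℤ) (p : Nat.Primes)
    (x : Fin s → IntegerAdeles) : Prop :=
  ∃ i j, i ≠ j ∧ ((p : ℕ) : ℤ_[(p : ℕ)]) ∣ MvPolynomial.aeval x (f i) p ∧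
    ((p : ℕ) : ℤ_[(p : ℕ)]) ∣ MvPolynomial.aeval x (f j) p

lemma excess_adeleExponent_eq_zero {s m : ℕ} {f : Fin m → MvPolynomial (Fin s) ℤ} {p : Nat.Primes}
    {x : Fin s → IntegerAdeles} (h : ¬ AdeleDividesTwo f p x) :
    excess (adeleExponent f p x) = 0 := by
  refine excess_eq_zero fun i j hij hi => ?_
  by_contra hj
  exact h ⟨i, j, hij, pow_dvd_of_toNat_emultiplicity_ne_zero hi,
    pow_dvd_of_toNat_emultiplicity_ne_zero hj⟩

lemma limitDenominator_eq_prod {s m : ℕ} {f : Fin m → MvPolynomial (Fin s) ℤ}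
    {x : Fin s → IntegerAdeles} {S : Finset Nat.Primes}
    (hS : ∀ p ∉ S, ¬ AdeleDividesTwo f p x) :
    limitDenominator f x = ∏ p ∈ S, (p : ℕ) ^ excess (adeleExponent f p x) := by
  refine finprod_eq_prod_of_mulSupport_subset _ fun p hp => ?_
  by_contra hpS
  exact hp (by simp only [excess_adeleExponent_eq_zero (hS p hpS), pow_zero])

/-- Two points with the same residues, with no value divisible by the full power of a prime in the
modulus, have the same exponents at these primes. -/
lemma adeleExponent_eq_intExponent {s m : ℕ} {f : Fin m → MvPolynomial (Fin s) ℤ}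
    {S : Finset Nat.Primes} {K : ℕ} {x : Fin s → IntegerAdeles} {u : Fin s → ℤ}
    (h : ∀ j, adeleReduction S K (x j) = u j) {p : Nat.Primes} (hp : p ∈ S)
    (hK : ∀ i, ¬ ((p : ℕ) : ℤ) ^ K ∣ MvPolynomial.eval u (f i)) :
    adeleExponent f p x = intExponent f p u := by
  funext i
  rw [adeleExponent, intExponent, primeExponent]
  congr 1
  have hi := adeleReduction_aeval h (f i)
  exact emultiplicity_congr (K := K) (fun k hk => pow_dvd_iff_of_adeleReduction_eq hi hp hk)
    fun h => hK i ((pow_dvd_iff_of_adeleReduction_eq hi hp le_rfl).1 h)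

lemma intCast_eval_congr {s M : ℕ} {u w : Fin s → ℤ}
    (h : ∀ j, (u j : ZMod M) = w j) (f : MvPolynomial (Fin s) ℤ) :
    ((MvPolynomial.eval u f : ℤ) : ZMod M) = (MvPolynomial.eval w f : ℤ) := by
  rw [MvPolynomial.intCast_eval, MvPolynomial.intCast_eval]
  simp only [h]

lemma intExponent_congr {s m : ℕ} {f : Fin m → MvPolynomial (Fin s) ℤ}
    {S : Finset Nat.Primes} {K : ℕ} {u w : Fin s → ℤ}
    (h : ∀ j, (u j : ZMod (adeleModulus S K)) = w j) {p : Nat.Primes} (hp : p ∈ S)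
    (hK : ∀ i, ¬ ((p : ℕ) : ℤ) ^ K ∣ MvPolynomial.eval w (f i)) :
    intExponent f p u = intExponent f p w := by
  funext i
  rw [intExponent, intExponent]
  congr 1
  have hi := intCast_eval_congr h (f i)
  exact emultiplicity_congr (K := K) (fun k hk => pow_dvd_iff_of_intCast_eq hi hp hk)
    fun h => hK i ((pow_dvd_iff_of_intCast_eq hi hp le_rfl).1 h)

/-- Integer representatives of a vector of residue classes. -/
def residueRep {s M : ℕ} (a : Fin s → ZMod M) (j : Fin s) : ℤ := ((a j).val : ℤ)

lemma intCast_residueRep {s M : ℕ} (hM : 0 < M) (a : Fin s → ZMod M) (j : Fin s) :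
    (residueRep a j : ZMod M) = a j := by
  have : NeZero M := ⟨hM.ne'⟩
  simp [residueRep]

/-- The residue classes at which the exponent of some prime in `S` in some value is not determined
by the residue, because the value is divisible by the full power of this prime in the modulus. -/
def Undetermined {s m : ℕ} (f : Fin m → MvPolynomial (Fin s) ℤ) (S : Finset Nat.Primes) (K : ℕ)
    (a : Fin s → ZMod (adeleModulus S K)) : Prop :=
  ∃ p ∈ S, ∃ i, ((p : ℕ) : ℤ) ^ K ∣ MvPolynomial.eval (residueRep a) (f i)

/-- The periodic approximation of the normalized least common multiple: the contribution of the
primes in `S`, computed at a fixed representative of the residue class. -/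
noncomputable def periodicNLCM {s m : ℕ} (f : Fin m → MvPolynomial (Fin s) ℤ)
    (S : Finset Nat.Primes) (K : ℕ) (a : Fin s → ZMod (adeleModulus S K)) : ℝ :=
  partialNLCM f S (residueRep a)

/-- The non-emptiness of `S` serves to exclude the value `0`, which is divisible by all powers. -/
lemma intNLCM_eq_periodicNLCM {s m : ℕ} {f : Fin m → MvPolynomial (Fin s) ℤ}
    {S : Finset Nat.Primes} (hSne : S.Nonempty) {K : ℕ} {u : Fin s → ℤ}
    (h1 : ¬ Undetermined f S K fun j => (u j : ZMod (adeleModulus S K)))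
    (h2 : ¬ ∃ p : Nat.Primes, p ∉ S ∧ DividesTwo f p u) :
    intNLCM (polyValues f u) = periodicNLCM f S K fun j => (u j : ZMod (adeleModulus S K)) := by
  set w := residueRep fun j => (u j : ZMod (adeleModulus S K)) with hw
  have hcong : ∀ j, (u j : ZMod (adeleModulus S K)) = w j := fun j =>
    (intCast_residueRep (adeleModulus_pos S K) (fun j => (u j : ZMod (adeleModulus S K))) j).symm
  unfold Undetermined at h1
  push Not at h1 h2
  obtain ⟨q, hq⟩ := hSne
  rw [intNLCM_eq_partialNLCM f u (fun i h0 => h1 q hq i ?_) S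
    fun p hp i j hij h => h2 p hp ⟨i, j, hij, h⟩, periodicNLCM, partialNLCM, partialNLCM]
  · congr 2
    exact Finset.prod_congr rfl fun p hp => by rw [intExponent_congr hcong hp (h1 p hp)]
  · rw [← pow_dvd_iff_of_intCast_eq (intCast_eval_congr hcong (f i)) hq le_rfl, h0]
    exact dvd_zero _

lemma inv_limitDenominator_eq_periodicNLCM {s m : ℕ} {f : Fin m → MvPolynomial (Fin s) ℤ}
    {S : Finset Nat.Primes} {K : ℕ} {x : Fin s → IntegerAdeles}
    (h1 : ¬ Undetermined f S K fun j => adeleReduction S K (x j))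
    (h2 : ∀ p ∉ S, ¬ AdeleDividesTwo f p x) :
    1 / (limitDenominator f x : ℝ) = periodicNLCM f S K fun j => adeleReduction S K (x j) := by
  unfold Undetermined at h1
  push Not at h1
  rw [limitDenominator_eq_prod h2, periodicNLCM, partialNLCM]
  congr 2
  refine Finset.prod_congr rfl fun p hp => ?_
  rw [adeleExponent_eq_intExponent (fun j => ?_) hp (h1 p hp)]
  exact (intCast_residueRep (adeleModulus_pos S K) (fun j => adeleReduction S K (x j)) j).symm

/-! ### Independent Haar distributed adeles -/

section Law

variable {s m : ℕ} {Ω' : Type*} [MeasurableSpace Ω'] {P' : Measure Ω'}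
  {V : Fin s → Ω' → IntegerAdeles}

lemma map_coordinates_eq_pi [IsProbabilityMeasure P']
    (hV : ∀ j, HasLaw (V j) adelesHaar P') (hVindep : iIndepFun V P')
    (p : Nat.Primes) :
    P'.map (fun ω j => V j ω p) = Measure.pi fun _ : Fin s => padicHaar (p : ℕ) := by
  have h1 := hVindep.comp (fun _ (x : IntegerAdeles) => x p) fun _ => measurable_pi_apply p
  refine ((iIndepFun_iff_map_fun_eq_pi_map fun j =>
    (measurable_pi_apply p).comp_aemeasurable (hV j).aemeasurable).1 h1).trans ?_
  congr 1
  funext j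
  have h2 := AEMeasurable.map_map_of_aemeasurable (μ := P') (f := V j)
    (g := fun x : IntegerAdeles => x p) (measurable_pi_apply p).aemeasurable (hV j).aemeasurable
  change P'.map ((fun x : IntegerAdeles => x p) ∘ V j) = _
  rw [← h2, (hV j).map_eq]
  exact Measure.infinitePi_map_eval (fun p : Nat.Primes => padicHaar (p : ℕ)) p

lemma aemeasurable_coordinates (hV : ∀ j, HasLaw (V j) adelesHaar P') (p : Nat.Primes) :
    AEMeasurable (fun ω j => V j ω p) P' :=
  aemeasurable_pi_lambda _ fun j =>
    (measurable_pi_apply p).comp_aemeasurable (hV j).aemeasurable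

lemma ae_aeval_coordinate_ne_zero [IsProbabilityMeasure P']
    (hV : ∀ j, HasLaw (V j) adelesHaar P')
    (hVindep : iIndepFun V P') {f : Fin m → MvPolynomial (Fin s) ℤ} (hf : ∀ i, f i ≠ 0) :
    ∀ᵐ ω ∂P', ∀ (p : Nat.Primes) i,
      MvPolynomial.aeval (fun j => V j ω) (f i) p ≠ 0 := by
  rw [ae_all_iff]
  intro p
  rw [ae_all_iff]
  intro i
  have h := ae_aeval_ne_zero (p : ℕ) (hf i)
  rw [← map_coordinates_eq_pi hV hVindep p] at h
  filter_upwards [ae_of_ae_map (aemeasurable_coordinates hV p) h] with ω hω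
  rwa [IntegerAdeles.aeval_apply]

lemma primeExponent_ne_top {p : Nat.Primes} {x : IntegerAdeles} (hx : x p ≠ 0) :
    primeExponent p x ≠ ⊤ := by
  rw [primeExponent, ← finiteMultiplicity_iff_emultiplicity_ne_top]
  exact FiniteMultiplicity.of_prime_left PadicInt.prime_p hx

lemma aemeasurable_adeleReduction (hV : ∀ j, HasLaw (V j) adelesHaar P')
    (S : Finset Nat.Primes) (K : ℕ) :
    AEMeasurable (fun ω j => adeleReduction S K (V j ω)) P' :=
  aemeasurable_pi_lambda _ fun j =>
    (measurable_adeleReduction S K).comp_aemeasurable (hV j).aemeasurable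

lemma measure_adeleReduction_eq (hV : ∀ j, HasLaw (V j) adelesHaar P') (hVindep : iIndepFun V P')
    (S : Finset Nat.Primes) (K : ℕ) (a : Fin s → ZMod (adeleModulus S K)) :
    P' {ω | (fun j => adeleReduction S K (V j ω)) = a} =
      ((adeleModulus S K : ENNReal)⁻¹) ^ s := by
  have hmeas : ∀ j, MeasurableSet (adeleReduction S K ⁻¹' {a j}) := fun j =>
    measurable_adeleReduction S K (measurableSet_singleton _)
  have h1 : {ω | (fun j => adeleReduction S K (V j ω)) = a} =
      ⋂ j ∈ (Finset.univ : Finset (Fin s)), V j ⁻¹' (adeleReduction S K ⁻¹' {a j}) := by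
    ext ω
    simp [funext_iff]
  rw [h1, hVindep.measure_inter_preimage_eq_mul Finset.univ fun j _ => hmeas j]
  have h2 : ∀ j, P' (V j ⁻¹' (adeleReduction S K ⁻¹' {a j})) = (adeleModulus S K : ENNReal)⁻¹ :=
    fun j => by
      rw [← Measure.map_apply_of_aemeasurable (hV j).aemeasurable (hmeas j), (hV j).map_eq,
        adelesHaar_preimage_adeleReduction]
  simp [h2]

lemma integral_adeleReduction [IsProbabilityMeasure P']
    (hV : ∀ j, HasLaw (V j) adelesHaar P') (hVindep : iIndepFun V P')
    (S : Finset Nat.Primes) (K : ℕ) [NeZero (adeleModulus S K)]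
    (H : (Fin s → ZMod (adeleModulus S K)) → ℝ) :
    ∫ ω, H (fun j => adeleReduction S K (V j ω)) ∂P' =
      ∑ a, (((adeleModulus S K : ℕ) : ℝ) ^ s)⁻¹ * H a := by
  have hW := aemeasurable_adeleReduction hV S K
  have := Measure.isProbabilityMeasure_map (μ := P') hW
  rw [← integral_map (f := H) hW (Measurable.of_discrete.aestronglyMeasurable),
    integral_fintype Integrable.of_finite]
  refine Finset.sum_congr rfl fun a _ => ?_
  have h1 : P'.map (fun ω j => adeleReduction S K (V j ω)) {a} =
      ((adeleModulus S K : ENNReal)⁻¹) ^ s := by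
    rw [Measure.map_apply_of_aemeasurable hW (measurableSet_singleton a)]
    exact measure_adeleReduction_eq hV hVindep S K a
  rw [measureReal_def, h1, smul_eq_mul]
  simp

/-- Averages over boxes of functions of the residue and of the rescaled point converge: the residue
becomes that of independent Haar distributed adeles, the rescaled point becomes uniform on the
cube, and the two become independent. -/
lemma tendsto_boxAverage_residue [IsProbabilityMeasure P']
    (hV : ∀ j, HasLaw (V j) adelesHaar P')
    (hVindep : iIndepFun V P') (S : Finset Nat.Primes) (K : ℕ)
    (H : (Fin s → ZMod (adeleModulus S K)) → ℝ) {ψ : ℝ → (Fin s → ℝ) → ℝ}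
    (hψ : ∀ l, Continuous (ψ l)) {g : ℕ → ℝ → (Fin s → ℤ) → ℝ} {B : ℝ}
    (hB : ∀ n l u, |g n l u| ≤ B)
    (hg : ∀ l, ∀ ε > 0, ∀ᶠ n in atTop, ∀ u ∈ gridBox s n,
      |g n l u - ψ l fun j => (u j : ℝ) / n| ≤ ε) :
    Tendsto (fun n => boxAverage s n fun u => g n (H fun j => (u j : ZMod (adeleModulus S K))) u)
      atTop (𝓝 (∫ ω, (∫ x in Set.Icc 0 1, ψ (H fun j => adeleReduction S K (V j ω)) x) ∂P')) := by
  have hM := adeleModulus_pos S K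
  have : NeZero (adeleModulus S K) := ⟨hM.ne'⟩
  rw [integral_adeleReduction hV hVindep S K fun a => ∫ x in Set.Icc 0 1, ψ (H a) x]
  refine (tendsto_finsetSum Finset.univ fun a _ => tendsto_boxAverage_residueClass hM a
    (hψ (H a)) (fun n u => hB n (H a) u) (hg (H a))).congr fun n => ?_
  simp only [boxAverage]
  rw [← Finset.sum_div, Finset.sum_comm]
  congr 1
  refine Finset.sum_congr rfl fun u _ => ?_
  rw [Finset.sum_ite_eq]
  simp

open scoped Classical in
lemma tendsto_boxAverage_residue_indicator [IsProbabilityMeasure P']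
    (hV : ∀ j, HasLaw (V j) adelesHaar P')
    (hVindep : iIndepFun V P') (S : Finset Nat.Primes) (K : ℕ)
    (A : (Fin s → ZMod (adeleModulus S K)) → Prop) :
    Tendsto (fun n => boxAverage s n fun u =>
        if A fun j => (u j : ZMod (adeleModulus S K)) then 1 else 0)
      atTop (𝓝 (P'.real {ω | A fun j => adeleReduction S K (V j ω)})) := by
  -- truncation to `[-1, 1]` makes the identity bounded and fixes the values of an indicator
  have h := tendsto_boxAverage_residue hV hVindep S K (fun a => if A a then 1 else 0)
    (ψ := fun l _ => max (-1) (min l 1)) (fun l => continuous_const)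
    (g := fun _ l _ => max (-1) (min l 1)) (B := 1)
    (fun n l u => abs_le.2 ⟨le_max_left _ _, max_le (by norm_num) (min_le_right _ _)⟩)
    (fun l ε hε => Eventually.of_forall fun n u _ => by simpa using hε.le)
  have e : ∀ (Q : Prop) [Decidable Q],
      max (-1 : ℝ) (min (if Q then 1 else 0) 1) = if Q then 1 else 0 := fun Q _ => by
    split_ifs <;> norm_num
  simp only [e] at h
  convert h using 2
  have hvol : volume.real (Set.Icc (0 : Fin s → ℝ) 1) = 1 := by
    simp [measureReal_def, Real.volume_Icc_pi]
  simp only [setIntegral_const, hvol, one_smul]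
  have : NeZero (adeleModulus S K) := ⟨(adeleModulus_pos S K).ne'⟩
  have hnull : NullMeasurableSet {ω | A fun j => adeleReduction S K (V j ω)} P' :=
    (aemeasurable_adeleReduction hV S K).nullMeasurableSet_preimage
      (s := {a | A a}) (MeasurableSet.of_discrete)
  have hind : (fun ω => if A fun j => adeleReduction S K (V j ω) then (1 : ℝ) else 0) =
      {ω | A fun j => adeleReduction S K (V j ω)}.indicator fun _ => 1 := by
    funext ω
    simp [Set.indicator_apply]
  rw [hind, integral_indicator₀ hnull, setIntegral_const, smul_eq_mul, mul_one]

end Law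

/-! ### Truncation errors at adelic points -/

section Approximation

variable {s m : ℕ} {Ω' : Type*} [MeasurableSpace Ω'] {P' : Measure Ω'}
  {V : Fin s → Ω' → IntegerAdeles} {f : Fin m → MvPolynomial (Fin s) ℤ}

lemma undetermined_adeleReduction_iff (S : Finset Nat.Primes) (K : ℕ) (x : Fin s → IntegerAdeles) :
    Undetermined f S K (fun j => adeleReduction S K (x j)) ↔
      ∃ p ∈ S, ∃ i, ((p : ℕ) : ℤ_[(p : ℕ)]) ^ K ∣ MvPolynomial.aeval x (f i) p := by
  have h : ∀ j, adeleReduction S K (x j) =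
      (residueRep (fun j => adeleReduction S K (x j)) j : ℤ) := fun j =>
    (intCast_residueRep (adeleModulus_pos S K) (fun j => adeleReduction S K (x j)) j).symm
  refine exists_congr fun p => and_congr_right fun hp => exists_congr fun i => ?_
  exact (pow_dvd_iff_of_adeleReduction_eq (adeleReduction_aeval h (f i)) hp le_rfl).symm

lemma nullMeasurableSet_pow_dvd (hV : ∀ j, HasLaw (V j) adelesHaar P') (p : Nat.Primes) (K : ℕ)
    (i : Fin m) :
    NullMeasurableSet {ω | ((p : ℕ) : ℤ_[(p : ℕ)]) ^ K ∣
      MvPolynomial.aeval (fun j => V j ω) (f i) p} P' := by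
  have h := ((MvPolynomial.continuous_aeval_int (A := ℤ_[(p : ℕ)]) (f i)).measurable
    |>.comp_aemeasurable (aemeasurable_coordinates hV p)).nullMeasurableSet_preimage
      (PadicInt.measurableSet_pow_dvd (p : ℕ) K 0)
  convert h using 1
  ext ω
  simp [IntegerAdeles.aeval_apply]

/-- The adelic values almost surely have no zero coordinate, so a high power of a given prime is
unlikely to divide them. -/
lemma tendsto_measure_undetermined [IsProbabilityMeasure P']
    (hV : ∀ j, HasLaw (V j) adelesHaar P')
    (hVindep : iIndepFun V P') (hf : ∀ i, f i ≠ 0) (S : Finset Nat.Primes) :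
    Tendsto (fun K => P' {ω | Undetermined f S K fun j => adeleReduction S K (V j ω)}) atTop
      (𝓝 0) := by
  have h1 : ∀ (p : Nat.Primes) (i : Fin m), Tendsto (fun K : ℕ => P' {ω |
      ((p : ℕ) : ℤ_[(p : ℕ)]) ^ K ∣ MvPolynomial.aeval (fun j => V j ω) (f i) p}) atTop (𝓝 0) := by
    intro p i
    have h := tendsto_measure_iInter_atTop (μ := P')
      (s := fun K : ℕ => {ω | ((p : ℕ) : ℤ_[(p : ℕ)]) ^ K ∣
        MvPolynomial.aeval (fun j => V j ω) (f i) p})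
      (fun K => nullMeasurableSet_pow_dvd hV p K i)
      (fun K K' hK ω hω => (pow_dvd_pow _ hK).trans hω) ⟨0, measure_ne_top _ _⟩
    have h0 : P' (⋂ K : ℕ, {ω | ((p : ℕ) : ℤ_[(p : ℕ)]) ^ K ∣
        MvPolynomial.aeval (fun j => V j ω) (f i) p}) = 0 := by
      refine measure_mono_null (fun ω hω => ?_)
        (ae_iff.1 (ae_aeval_coordinate_ne_zero hV hVindep hf))
      rw [Set.mem_iInter] at hω
      intro hne
      obtain ⟨k, hk⟩ := FiniteMultiplicity.of_prime_left
        (PadicInt.prime_p (p := (p : ℕ))) (hne p i)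
      exact hk (hω (k + 1))
    rwa [h0] at h
  have h2 : Tendsto (fun K : ℕ => ∑ p ∈ S, ∑ i, P' {ω |
      ((p : ℕ) : ℤ_[(p : ℕ)]) ^ K ∣ MvPolynomial.aeval (fun j => V j ω) (f i) p}) atTop
      (𝓝 0) := by
    have := tendsto_finsetSum S fun p _ => tendsto_finsetSum (Finset.univ : Finset (Fin m))
      fun i _ => h1 p i
    simpa using this
  refine tendsto_of_tendsto_of_tendsto_of_le_of_le tendsto_const_nhds h2
    (fun _ => bot_le) fun K => ?_
  have h3 : {ω | Undetermined f S K fun j => adeleReduction S K (V j ω)} =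
      ⋃ p ∈ S, ⋃ i ∈ (Finset.univ : Finset (Fin m)), {ω | ((p : ℕ) : ℤ_[(p : ℕ)]) ^ K ∣
        MvPolynomial.aeval (fun j => V j ω) (f i) p} := by
    ext ω
    simp only [Set.mem_ofPred_eq, undetermined_adeleReduction_iff, Set.mem_iUnion,
      Finset.mem_univ, exists_prop, true_and]
  rw [h3]
  exact (measure_biUnion_finset_le _ _).trans
    (Finset.sum_le_sum fun p _ => measure_biUnion_finset_le _ _)

lemma adeleDividesTwo_iff {S : Finset Nat.Primes} {K : ℕ} (hK : 1 ≤ K) {p : Nat.Primes}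
    (hp : p ∈ S) (x : Fin s → IntegerAdeles) :
    AdeleDividesTwo f p x ↔
      DividesTwo f p (residueRep fun j => adeleReduction S K (x j)) := by
  have h : ∀ j, adeleReduction S K (x j) =
      (residueRep (fun j => adeleReduction S K (x j)) j : ℤ) := fun j =>
    (intCast_residueRep (adeleModulus_pos S K) (fun j => adeleReduction S K (x j)) j).symm
  refine exists_congr fun i => exists_congr fun j => and_congr_right fun _ => ?_
  have h1 := pow_dvd_iff_of_adeleReduction_eq (adeleReduction_aeval h (f i)) hp hK
  have h2 := pow_dvd_iff_of_adeleReduction_eq (adeleReduction_aeval h (f j)) hp hK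
  rw [pow_one, pow_one] at h1 h2
  exact and_congr h1 h2

lemma dividesTwo_iff {S : Finset Nat.Primes} {K : ℕ} (hK : 1 ≤ K) {p : Nat.Primes}
    (hp : p ∈ S) (u : Fin s → ℤ) :
    DividesTwo f p u ↔
      DividesTwo f p (residueRep fun j => (u j : ZMod (adeleModulus S K))) := by
  have h : ∀ j, (u j : ZMod (adeleModulus S K)) =
      (residueRep (fun j => (u j : ZMod (adeleModulus S K))) j : ℤ) := fun j =>
    (intCast_residueRep (adeleModulus_pos S K) (fun j => (u j : ZMod (adeleModulus S K))) j).symm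
  refine exists_congr fun i => exists_congr fun j => and_congr_right fun _ => ?_
  have h1 := pow_dvd_iff_of_intCast_eq (intCast_eval_congr h (f i)) hp hK
  have h2 := pow_dvd_iff_of_intCast_eq (intCast_eval_congr h (f j)) hp hK
  rw [pow_one] at h1 h2
  exact and_congr h1 h2

/-- The sieve bound for a single prime passes to the limit of large boxes. -/
lemma exists_measure_adeleDividesTwo_le [IsProbabilityMeasure P']
    (hV : ∀ j, HasLaw (V j) adelesHaar P')
    (hVindep : iIndepFun V P') (hf : ∀ i, f i ≠ 0)
    (hfactor : ∀ i j, i ≠ j → ∀ h : MvPolynomial (Fin s) ℤ, h ∣ f i → h ∣ f j →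
      h.totalDegree = 0) :
    ∃ C : ℝ, 0 ≤ C ∧ ∀ p : Nat.Primes,
      P'.real {ω | AdeleDividesTwo f p fun j => V j ω} ≤ C * (((p : ℕ) : ℝ) ^ 2)⁻¹ := by
  classical
  obtain ⟨C, hC⟩ := exists_card_dividesTwo_le hf hfactor
  refine ⟨C, by positivity, fun p => ?_⟩
  have hpS : p ∈ ({p} : Finset Nat.Primes) := Finset.mem_singleton_self p
  have h := tendsto_boxAverage_residue_indicator hV hVindep {p} 1
    fun a => DividesTwo f p (residueRep a)
  simp only [← adeleDividesTwo_iff le_rfl hpS, ← dividesTwo_iff le_rfl hpS] at h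
  refine le_of_tendsto h ?_
  filter_upwards [eventually_ge_atTop (p : ℕ)] with n hn
  have hp0 : (0 : ℝ) < (p : ℕ) := by exact_mod_cast p.2.pos
  have hn' : (0 : ℝ) < n := by exact_mod_cast p.2.pos.trans_le hn
  rw [boxAverage, Finset.sum_boole, div_le_iff₀ (by positivity), ← div_eq_mul_inv,
    div_mul_eq_mul_div, le_div_iff₀ (by positivity), mul_comm]
  have := hC n p p.2 hn
  exact_mod_cast this

/-- Borel–Cantelli, as `∑ p ^ (-2)` converges. -/
lemma ae_finite_adeleDividesTwo [IsProbabilityMeasure P']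
    (hV : ∀ j, HasLaw (V j) adelesHaar P')
    (hVindep : iIndepFun V P') (hf : ∀ i, f i ≠ 0)
    (hfactor : ∀ i j, i ≠ j → ∀ h : MvPolynomial (Fin s) ℤ, h ∣ f i → h ∣ f j →
      h.totalDegree = 0) :
    ∀ᵐ ω ∂P', {p : Nat.Primes | AdeleDividesTwo f p fun j => V j ω}.Finite := by
  obtain ⟨C, hC0, hC⟩ := exists_measure_adeleDividesTwo_le hV hVindep hf hfactor
  refine ae_finite_setOfPred_mem
    (s := fun p : Nat.Primes => {ω | AdeleDividesTwo f p fun j => V j ω}) ?_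
  have hs : Summable fun p : Nat.Primes => C * (((p : ℕ) : ℝ) ^ 2)⁻¹ :=
    summable_primes_inv_sq.mul_left C
  refine ne_top_of_le_ne_top hs.tsum_ofReal_ne_top (ENNReal.tsum_le_tsum fun p => ?_)
  rw [← ofReal_measureReal]
  exact ENNReal.ofReal_le_ofReal (hC p)

lemma exists_measure_adeleDividesTwo_outside_le [IsProbabilityMeasure P']
    (hV : ∀ j, HasLaw (V j) adelesHaar P')
    (hVindep : iIndepFun V P') (hf : ∀ i, f i ≠ 0)
    (hfactor : ∀ i j, i ≠ j → ∀ h : MvPolynomial (Fin s) ℤ, h ∣ f i → h ∣ f j →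
      h.totalDegree = 0) :
    ∃ C : ℝ, ∀ S : Finset Nat.Primes,
      P'.real {ω | ∃ p ∉ S, AdeleDividesTwo f p fun j => V j ω} ≤ C * primeTail S := by
  obtain ⟨C, hC0, hC⟩ := exists_measure_adeleDividesTwo_le hV hVindep hf hfactor
  refine ⟨C, fun S => ?_⟩
  have hs : Summable fun p : {p : Nat.Primes // p ∉ S} => C * (((p.1 : ℕ) : ℝ) ^ 2)⁻¹ :=
    (summable_primes_inv_sq.comp_injective (i := Subtype.val) Subtype.val_injective).mul_left C
  have h1 : {ω | ∃ p ∉ S, AdeleDividesTwo f p fun j => V j ω} =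
      ⋃ p : {p : Nat.Primes // p ∉ S}, {ω | AdeleDividesTwo f p.1 fun j => V j ω} := by
    ext ω
    simp
  have h2 : P' {ω | ∃ p ∉ S, AdeleDividesTwo f p fun j => V j ω} ≤
      ENNReal.ofReal (C * primeTail S) := by
    rw [h1, primeTail, ← tsum_mul_left, ENNReal.ofReal_tsum_of_nonneg (fun _ => by positivity) hs]
    refine (measure_iUnion_le _).trans (ENNReal.tsum_le_tsum fun p => ?_)
    rw [← ofReal_measureReal]
    exact ENNReal.ofReal_le_ofReal (hC p.1)
  refine ENNReal.toReal_le_of_le_ofReal (mul_nonneg hC0 (tsum_nonneg fun _ => by positivity)) h2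

lemma measurable_emultiplicity_padicInt (p : ℕ) [Fact p.Prime] :
    Measurable fun x : ℤ_[p] => (emultiplicity (p : ℤ_[p]) x).toNat := by
  refine measurable_to_countable' fun k => ?_
  have hpow : ∀ k, MeasurableSet {x : ℤ_[p] | (p : ℤ_[p]) ^ k ∣ x} := fun k => by
    simpa using PadicInt.measurableSet_pow_dvd p k 0
  have h : (fun x : ℤ_[p] => (emultiplicity (p : ℤ_[p]) x).toNat) ⁻¹' {k} =
      ({x | (p : ℤ_[p]) ^ k ∣ x} \ {x | (p : ℤ_[p]) ^ (k + 1) ∣ x}) ∪ {x | x = 0 ∧ k = 0} := by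
    ext x
    by_cases hx : x = 0
    · subst hx
      simp [eq_comm]
    · have hfin : FiniteMultiplicity (p : ℤ_[p]) x :=
        FiniteMultiplicity.of_prime_left PadicInt.prime_p hx
      simp only [Set.mem_preimage, Set.mem_singleton_iff, Set.mem_union, Set.mem_sdiff,
        Set.mem_ofPred_eq, hx, false_and, or_false]
      rw [hfin.emultiplicity_eq_multiplicity, ENat.toNat_natCast, hfin.multiplicity_eq_iff]
  rw [h]
  refine ((hpow k).diff (hpow (k + 1))).union ?_
  by_cases hk : k = 0
  · simp [hk]
  · simp [hk]

/-- The variable is almost surely the limit, indeed the eventual value, of finite products. -/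
lemma aemeasurable_inv_limitDenominator [IsProbabilityMeasure P']
    (hV : ∀ j, HasLaw (V j) adelesHaar P')
    (hVindep : iIndepFun V P') (hf : ∀ i, f i ≠ 0)
    (hfactor : ∀ i j, i ≠ j → ∀ h : MvPolynomial (Fin s) ℤ, h ∣ f i → h ∣ f j →
      h.totalDegree = 0) :
    AEMeasurable (fun ω => 1 / (limitDenominator f (fun j => V j ω) : ℝ)) P' := by
  have hexp : ∀ p : Nat.Primes,
      AEMeasurable (fun ω => excess (adeleExponent f p fun j => V j ω)) P' := by
    intro p
    have h : AEMeasurable (fun ω => adeleExponent f p fun j => V j ω) P' := by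
      refine aemeasurable_pi_lambda _ fun i => ?_
      have h1 := (measurable_emultiplicity_padicInt (p : ℕ)).comp_aemeasurable
        ((MvPolynomial.continuous_aeval_int (A := ℤ_[(p : ℕ)]) (f i)).measurable.comp_aemeasurable
          (aemeasurable_coordinates hV p))
      convert h1 using 2 with ω
      simp [adeleExponent, primeExponent, IntegerAdeles.aeval_apply]
    exact (Measurable.of_discrete (f := excess (m := m))).comp_aemeasurable h
  refine aemeasurable_of_tendsto_metrizable_ae (atTop : Filter (Finset Nat.Primes))
    (f := fun (S : Finset Nat.Primes) ω => 1 /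
      ((∏ p ∈ S, (p : ℕ) ^ excess (adeleExponent f p fun j => V j ω) : ℕ) : ℝ))
    (fun S => ?_) ?_
  · have h1 : AEMeasurable (fun ω => ∏ p ∈ S, (p : ℕ) ^ excess (adeleExponent f p fun j => V j ω))
        P' :=
      Finset.aemeasurable_fun_prod S fun p _ =>
        (Measurable.of_discrete (f := fun k : ℕ => (p : ℕ) ^ k)).comp_aemeasurable (hexp p)
    exact (Measurable.of_discrete (f := fun k : ℕ => 1 / (k : ℝ))).comp_aemeasurable h1
  · filter_upwards [ae_finite_adeleDividesTwo hV hVindep hf hfactor] with ω hω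
    refine tendsto_const_nhds.congr' ?_
    filter_upwards [eventually_ge_atTop hω.toFinset] with S hS
    rw [limitDenominator_eq_prod (S := S) fun p hp h => hp (hS (hω.mem_toFinset.2 h))]

end Approximation

/-! ### Convergence of averages over boxes -/

lemma abs_integral_sub_le_of_eqOn_compl {Ω' : Type*} [MeasurableSpace Ω'] {P' : Measure Ω'}
    [IsProbabilityMeasure P'] {F G : Ω' → ℝ} (hF : Integrable F P') (hG : Integrable G P') {B : ℝ}
    (hFB : ∀ ω, |F ω| ≤ B) (hGB : ∀ ω, |G ω| ≤ B) {A : Set Ω'} (hA : ∀ᵐ ω ∂P', ω ∉ A → F ω = G ω) :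
    |∫ ω, F ω ∂P' - ∫ ω, G ω ∂P'| ≤ 2 * B * P'.real A := by
  rw [← integral_sub hF hG]
  have hm : MeasurableSet (toMeasurable P' A) := measurableSet_toMeasurable P' A
  have h1 : |∫ ω, (F ω - G ω) ∂P'| ≤
      ∫ ω, (toMeasurable P' A).indicator (fun _ => 2 * B) ω ∂P' := by
    have hint : Integrable (fun _ : Ω' => 2 * B) P' := integrable_const _
    rw [← Real.norm_eq_abs]
    refine norm_integral_le_of_norm_le (hint.indicator hm) ?_
    filter_upwards [hA] with ω hω
    by_cases h : ω ∈ toMeasurable P' A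
    · rw [Set.indicator_of_mem h, Real.norm_eq_abs]
      have := abs_sub (F ω) (G ω)
      have := hFB ω
      have := hGB ω
      linarith
    · rw [Set.indicator_of_notMem h, hω fun h' => h (subset_toMeasurable P' A h'), sub_self,
        norm_zero]
  refine h1.trans_eq ?_
  rw [integral_indicator hm, setIntegral_const, smul_eq_mul, mul_comm, measureReal_def,
    measure_toMeasurable, measureReal_def]

lemma abs_boxAverage_sub_le_of_eqOn {s n : ℕ} (hn : 0 < n) {g g' : (Fin s → ℤ) → ℝ} {B : ℝ}
    (hg : ∀ u, |g u| ≤ B) (hg' : ∀ u, |g' u| ≤ B) (Q R : (Fin s → ℤ) → Prop) [DecidablePred Q]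
    [DecidablePred R] (h : ∀ u, ¬ Q u → ¬ R u → g u = g' u) :
    |boxAverage s n g - boxAverage s n g'| ≤
      2 * B * (boxAverage s n (fun u => if Q u then 1 else 0) +
        ((gridBox s n).filter R).card / (n : ℝ) ^ s) := by
  have hn' : (0 : ℝ) < (n : ℝ) ^ s := by positivity
  have hB : 0 ≤ B := (abs_nonneg _).trans (hg 0)
  have h2 : ∀ u, |g u - g' u| ≤ 2 * B * ((if Q u then 1 else 0) + if R u then 1 else 0) := by
    intro u
    have h3 : |g u - g' u| ≤ 2 * B := by
      have := abs_sub (g u) (g' u)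
      have := hg u
      have := hg' u
      linarith
    by_cases hQ : Q u <;> by_cases hR : R u <;> simp only [hQ, hR, if_true, if_false]
    · linarith
    · linarith
    · linarith
    · simp [h u hQ hR]
  have h4 : ((gridBox s n).filter R).card / (n : ℝ) ^ s =
      boxAverage s n fun u => if R u then 1 else 0 := by
    rw [boxAverage, Finset.sum_boole]
  rw [h4, boxAverage, boxAverage, boxAverage, boxAverage, ← sub_div, ← Finset.sum_sub_distrib,
    ← add_div, ← Finset.sum_add_distrib, abs_div, abs_of_pos hn', mul_div_assoc', Finset.mul_sum]
  gcongr
  exact (Finset.abs_sum_le_sum_abs _ _).trans (Finset.sum_le_sum fun u _ => h2 u)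

/-- Averages over boxes of functions of the normalized least common multiple and of the rescaled
point converge: outside an event of small probability, uniformly in the size of the box, the
normalized least common multiple is a function of the residue modulo a fixed integer. The functions
`g n` may depend on `n`, as long as they approach `ψ` at the rescaled point uniformly. -/
theorem tendsto_boxAverage_intNLCM {s m : ℕ} {Ω' : Type*} [MeasurableSpace Ω'] {P' : Measure Ω'}
    [IsProbabilityMeasure P'] {V : Fin s → Ω' → IntegerAdeles}
    {f : Fin m → MvPolynomial (Fin s) ℤ}
    (hV : ∀ j, HasLaw (V j) adelesHaar P')
    (hVindep : iIndepFun V P') (hf : ∀ i, f i ≠ 0)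
    (hfactor : ∀ i j, i ≠ j → ∀ h : MvPolynomial (Fin s) ℤ, h ∣ f i → h ∣ f j →
      h.totalDegree = 0)
    {L : Ω' → ℝ} (hLm : Measurable L)
    (hL : ∀ᵐ ω ∂P', L ω = 1 / (limitDenominator f (fun j => V j ω) : ℝ))
    {ψ : ℝ → (Fin s → ℝ) → ℝ} (hψ : ∀ l, Continuous (ψ l))
    (hψm : Measurable fun l => ∫ x in Set.Icc 0 1, ψ l x) {g : ℕ → ℝ → (Fin s → ℤ) → ℝ} {B : ℝ}
    (hψB : ∀ l x, |ψ l x| ≤ B) (hB : ∀ n l u, |g n l u| ≤ B)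
    (hg : ∀ l, ∀ ε > 0, ∀ᶠ n in atTop, ∀ u ∈ gridBox s n,
      |g n l u - ψ l fun j => (u j : ℝ) / n| ≤ ε) :
    Tendsto (fun n => boxAverage s n fun u => g n (intNLCM (polyValues f u)) u) atTop
      (𝓝 (∫ ω, (∫ x in Set.Icc 0 1, ψ (L ω) x) ∂P')) := by
  classical
  obtain ⟨C₁, -, hC₁⟩ := exists_dividesTwo_outside_le hf hfactor
  obtain ⟨C₂, hC₂⟩ := exists_measure_adeleDividesTwo_outside_le hV hVindep hf hfactor
  have hB0 : 0 ≤ B := (abs_nonneg _).trans (hB 0 0 0)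
  have hvol : volume.real (Set.Icc (0 : Fin s → ℝ) 1) = 1 := by
    simp [measureReal_def, Real.volume_Icc_pi]
  have hvol' : volume (Set.Icc (0 : Fin s → ℝ) 1) < ⊤ := by
    simp [Real.volume_Icc_pi]
  have hΨB : ∀ l, |∫ x in Set.Icc 0 1, ψ l x| ≤ B := fun l => by
    have := norm_setIntegral_le_of_norm_le_const (μ := volume) (s := Set.Icc (0 : Fin s → ℝ) 1)
      (f := ψ l) (C := B) hvol' fun x _ => hψB l x
    rwa [hvol, mul_one] at this
  rw [Metric.tendsto_nhds]
  intro ε hε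
  -- both replacements below cost at most `4 * B * δ`
  set δ := ε / (16 * (B + 1)) with hδ
  have hδ0 : 0 < δ := by positivity
  have hδB : 2 * B * (δ + δ) + 2 * B * (δ + δ) < ε / 2 := by
    rw [hδ]
    field_simp
    nlinarith
  -- a finite set of primes outside of which it is unlikely that a prime divides two values
  have hS : ∀ C : ℝ, ∀ᶠ S in (atTop : Filter (Finset Nat.Primes)), C * primeTail S < δ := by
    intro C
    have := tendsto_primeTail.const_mul C
    rw [mul_zero] at this
    exact this.eventually (gt_mem_nhds hδ0)
  obtain ⟨S, hS₁, hS₂, hS₃⟩ := ((hS C₁).and ((hS C₂).and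
    (eventually_ge_atTop ({⟨2, Nat.prime_two⟩} : Finset Nat.Primes)))).exists
  have hSne : S.Nonempty := ⟨_, hS₃ (Finset.mem_singleton_self _)⟩
  -- a power of these primes that is unlikely to divide a value
  obtain ⟨K, hK⟩ := ((tendsto_measure_undetermined hV hVindep hf S).eventually
    (gt_mem_nhds (ENNReal.ofReal_pos.2 hδ0))).exists
  have hK' : P'.real {ω | Undetermined f S K fun j => adeleReduction S K (V j ω)} < δ :=
    ENNReal.toReal_lt_of_lt_ofReal hK
  have hy := tendsto_boxAverage_residue hV hVindep S K (periodicNLCM f S K) hψ hB hg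
  set y := ∫ ω, (∫ x in Set.Icc 0 1,
    ψ (periodicNLCM f S K fun j => adeleReduction S K (V j ω)) x) ∂P' with hydef
  have hM : NeZero (adeleModulus S K) := ⟨(adeleModulus_pos S K).ne'⟩
  have hxy : |∫ ω, (∫ x in Set.Icc 0 1, ψ (L ω) x) ∂P' - y| ≤ 2 * B * (δ + δ) := by
    have hint : ∀ T : Ω' → ℝ, AEMeasurable T P' →
        Integrable (fun ω => ∫ x in Set.Icc 0 1, ψ (T ω) x) P' := fun T hT =>
      (integrable_const B).mono' (hψm.comp_aemeasurable hT).aestronglyMeasurable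
        (Eventually.of_forall fun ω => hΨB _)
    have h1 := abs_integral_sub_le_of_eqOn_compl (hint L hLm.aemeasurable)
      (hint (fun ω => periodicNLCM f S K fun j => adeleReduction S K (V j ω))
        ((Measurable.of_discrete (f := periodicNLCM f S K)).comp_aemeasurable
          (aemeasurable_adeleReduction hV S K)))
      (fun ω => hΨB _) (fun ω => hΨB _)
      (A := {ω | Undetermined f S K fun j => adeleReduction S K (V j ω)} ∪
        {ω | ∃ p ∉ S, AdeleDividesTwo f p fun j => V j ω}) (by
        filter_upwards [hL] with ω hω hωA
        rw [Set.mem_union, not_or] at hωA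
        rw [hω, inv_limitDenominator_eq_periodicNLCM hωA.1 fun p hp h => hωA.2 ⟨p, hp, h⟩])
    refine h1.trans (mul_le_mul_of_nonneg_left ?_ (by positivity))
    exact (measureReal_union_le _ _).trans (add_le_add hK'.le ((hC₂ S).trans hS₂.le))
  have hund := (tendsto_boxAverage_residue_indicator hV hVindep S K
    (Undetermined f S K)).eventually (gt_mem_nhds hK')
  have htail : ∀ᶠ n : ℕ in atTop, C₁ * (primeTail S + 1 / (n : ℝ)) < δ := by
    have : Tendsto (fun n : ℕ => C₁ * (primeTail S + 1 / (n : ℝ))) atTop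
        (𝓝 (C₁ * (primeTail S + 0))) :=
      (tendsto_one_div_atTop_nhds_zero_nat.const_add _).const_mul _
    rw [add_zero] at this
    exact this.eventually (gt_mem_nhds hS₁)
  filter_upwards [hund, htail, eventually_gt_atTop 0,
    hy.eventually (Metric.ball_mem_nhds y (half_pos hε))] with n hn1 hn2 hn0 hn3
  rw [Real.dist_eq] at hn3
  have hn' : (0 : ℝ) < (n : ℝ) ^ s := by positivity
  have h1 := abs_boxAverage_sub_le_of_eqOn hn0
    (g := fun u => g n (intNLCM (polyValues f u)) u)
    (g' := fun u => g n (periodicNLCM f S K fun j => (u j : ZMod (adeleModulus S K))) u)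
    (fun u => hB _ _ _) (fun u => hB _ _ _)
    (fun u => Undetermined f S K fun j => (u j : ZMod (adeleModulus S K)))
    (fun u => ∃ p : Nat.Primes, p ∉ S ∧ DividesTwo f p u)
    fun u hu1 hu2 => by rw [intNLCM_eq_periodicNLCM hSne hu1 hu2]
  have h2 : (((gridBox s n).filter fun u =>
      ∃ p : Nat.Primes, p ∉ S ∧ DividesTwo f p u).card : ℝ) / (n : ℝ) ^ s ≤ δ := by
    rw [div_le_iff₀ hn']
    exact (hC₁ S n hn0).trans (mul_le_mul_of_nonneg_right hn2.le hn'.le)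
  have h3 := h1.trans (mul_le_mul_of_nonneg_left (add_le_add hn1.le h2) (by positivity))
  rw [abs_sub_comm] at hxy
  rw [Real.dist_eq]
  have h4 := abs_sub_le (boxAverage s n fun u => g n (intNLCM (polyValues f u)) u)
    (boxAverage s n fun u => g n (periodicNLCM f S K fun j => (u j : ZMod (adeleModulus S K))) u) y
  have h5 := abs_sub_le (boxAverage s n fun u => g n (intNLCM (polyValues f u)) u) y
    (∫ ω, (∫ x in Set.Icc 0 1, ψ (L ω) x) ∂P')
  linarith

/-! ### Uniform points of boxes and top forms -/

lemma integral_uniformGrid (s : ℕ) (n : ℕ+) (F : (Fin s → ℤ) → ℝ) :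
    ∫ u, F u ∂uniformGrid s n = boxAverage s n F := by
  have h1 : {x : Fin s → ℤ | ∀ j, 1 ≤ x j ∧ x j ≤ (n : ℤ)} = gridBox s n :=
    Set.ext fun u => mem_gridBox.symm
  rw [uniformGrid, uniformOn, ProbabilityTheory.cond, h1, integral_smul_measure, setIntegral_finset,
    Measure.count_apply_finset, card_gridBox, boxAverage, div_eq_inv_mul]
  · simp
  · rw [← Set.biUnion_of_singleton (gridBox s n : Set (Fin s → ℤ))]
    exact (integrableOn_finset_iUnion (s := gridBox s n)).2 fun u _ => integrableOn_singleton
      (hx := by rw [Measure.count_singleton]; exact ENNReal.one_lt_top)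

lemma MvPolynomial.aeval_mul_of_isHomogeneous {s d : ℕ} {f : MvPolynomial (Fin s) ℤ}
    (hf : f.IsHomogeneous d) (c : ℝ) (x : Fin s → ℝ) :
    aeval (fun j => c * x j) f = c ^ d * aeval x f := by
  rw [aeval_def, aeval_def, eval₂_eq', eval₂_eq', Finset.mul_sum]
  refine Finset.sum_congr rfl fun e he => ?_
  have h : ∑ j, e j = d := by
    rw [hf.degree_eq_sum_deg_support he]
    exact (Finset.sum_subset (Finset.subset_univ _) fun j _ hj =>
      Finsupp.notMem_support_iff.1 hj).symm
  simp_rw [mul_pow]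
  rw [Finset.prod_mul_distrib, Finset.prod_pow_eq_pow_sum, h]
  ring

/-- On the box with side `n`, a polynomial of degree `d` divided by `n ^ d` is its top form at the
rescaled point, up to an error of order `1 / n`. -/
lemma exists_abs_eval_sub_topForm_le {s : ℕ} (f : MvPolynomial (Fin s) ℤ) :
    ∃ C : ℕ, ∀ n : ℕ, 0 < n → ∀ u ∈ gridBox s n,
      |((MvPolynomial.eval u f : ℤ) : ℝ) / (n : ℝ) ^ f.totalDegree -
        MvPolynomial.aeval (fun j => (u j : ℝ) / n) (topForm f)| ≤ C / n := by
  have hsum : f = ∑ k ∈ Finset.range f.totalDegree, MvPolynomial.homogeneousComponent k f +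
      topForm f := by
    conv_lhs => rw [← MvPolynomial.sum_homogeneousComponent f, Finset.sum_range_succ]
    rfl
  set r := ∑ k ∈ Finset.range f.totalDegree, MvPolynomial.homogeneousComponent k f with hr
  obtain ⟨C, hC⟩ := exists_natAbs_eval_le r
  refine ⟨C, fun n hn u hu => ?_⟩
  have hn' : (0 : ℝ) < n := by exact_mod_cast hn
  have h1 : MvPolynomial.aeval (fun j => (u j : ℝ) / n) (topForm f) =
      ((MvPolynomial.eval u (topForm f) : ℤ) : ℝ) / (n : ℝ) ^ f.totalDegree := by
    have := MvPolynomial.aeval_mul_of_isHomogeneous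
      (MvPolynomial.homogeneousComponent_isHomogeneous f.totalDegree f) (n : ℝ)⁻¹ fun j => (u j : ℝ)
    rw [← MvPolynomial.intCast_eval] at this
    simp_rw [← div_eq_inv_mul] at this
    rw [topForm, this, inv_pow, ← div_eq_inv_mul]
  have h2 : MvPolynomial.eval u f = MvPolynomial.eval u r + MvPolynomial.eval u (topForm f) := by
    conv_lhs => rw [hsum, map_add]
  rw [h1, ← sub_div, h2, Int.cast_add, add_sub_cancel_right, abs_div, abs_of_pos (pow_pos hn' _),
    div_le_div_iff₀ (by positivity) hn']
  have h3 : |((MvPolynomial.eval u r : ℤ) : ℝ)| ≤ C * (n : ℝ) ^ r.totalDegree := by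
    rw [← Int.cast_abs, Int.abs_eq_natAbs]
    exact_mod_cast hC n hn u hu
  -- in degree `0` the remainder `r` is `0`; otherwise its degree is smaller than that of `f`
  rcases Nat.eq_zero_or_pos f.totalDegree with hd | hd
  · have hr0 : r = 0 := by rw [hr, hd, Finset.range_zero, Finset.sum_empty]
    rw [hr0, map_zero, Int.cast_zero, abs_zero, zero_mul]
    positivity
  · have hrd : r.totalDegree + 1 ≤ f.totalDegree := by
      have : r.totalDegree ≤ f.totalDegree - 1 :=
        MvPolynomial.totalDegree_finsetSum_le fun k hk =>
          (MvPolynomial.homogeneousComponent_isHomogeneous k f).totalDegree_le.trans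
            (by have := Finset.mem_range.1 hk; omega)
      omega
    calc _ ≤ C * (n : ℝ) ^ r.totalDegree * n := mul_le_mul_of_nonneg_right h3 hn'.le
      _ = C * (n : ℝ) ^ (r.totalDegree + 1) := by rw [pow_succ, mul_assoc]
      _ ≤ _ := by
        gcongr
        exact_mod_cast hn

/-- A continuous function of the rescaled values of the polynomials is uniformly close to the same
function of the values of the top forms at the rescaled point. -/
lemma eventually_abs_sub_topForm_le {s m : ℕ} (f : Fin m → MvPolynomial (Fin s) ℤ)
    {h : (Fin m → ℝ) → ℝ} (hh : Continuous h) {ε : ℝ} (hε : 0 < ε) :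
    ∀ᶠ n : ℕ in atTop, ∀ u ∈ gridBox s n,
      |h (fun i => ((MvPolynomial.eval u (f i) : ℤ) : ℝ) / (n : ℝ) ^ (f i).totalDegree) -
        h fun i => MvPolynomial.aeval (fun j => (u j : ℝ) / n) (topForm (f i))| ≤ ε := by
  choose C hC using fun i => exists_abs_eval_sub_topForm_le (f i)
  choose D hD using fun i => exists_natAbs_eval_le (f i)
  set R : ℝ := ∑ i, ((C i : ℝ) + D i) with hR
  have hCR : ∀ i, (C i : ℝ) + D i ≤ R := fun i =>
    Finset.single_le_sum (f := fun i => (C i : ℝ) + D i) (fun i _ => by positivity)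
      (Finset.mem_univ i)
  have hR0 : 0 ≤ R := Finset.sum_nonneg fun i _ => by positivity
  have huc := (isCompact_closedBall (0 : Fin m → ℝ) R).uniformContinuousOn_of_continuous
    hh.continuousOn
  rw [Metric.uniformContinuousOn_iff_le] at huc
  obtain ⟨δ, hδ, huc⟩ := huc ε hε
  have hlim : ∀ᶠ n : ℕ in atTop, R / n < δ :=
    (tendsto_const_div_atTop_nhds_zero_nat R).eventually (gt_mem_nhds hδ)
  filter_upwards [hlim, eventually_gt_atTop 0] with n hn hn0 u hu
  have hn' : (1 : ℝ) ≤ n := by exact_mod_cast hn0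
  have hn1 : (0 : ℝ) < n := by linarith
  have hD' : ∀ i, |((MvPolynomial.eval u (f i) : ℤ) : ℝ) / (n : ℝ) ^ (f i).totalDegree| ≤ D i := by
    intro i
    rw [abs_div, abs_of_pos (pow_pos hn1 _), div_le_iff₀ (pow_pos hn1 _), ← Int.cast_abs,
      Int.abs_eq_natAbs]
    exact_mod_cast hD i n hn0 u hu
  have hC1 : ∀ i, (C i : ℝ) / n ≤ C i := fun i => div_le_self (by positivity) hn'
  refine huc _ ?_ _ ?_ ?_
  · rw [mem_closedBall_zero_iff, pi_norm_le_iff_of_nonneg hR0]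
    intro i
    have := hCR i
    have := hD' i
    have : (0 : ℝ) ≤ C i := by positivity
    rw [Real.norm_eq_abs]
    linarith
  · rw [mem_closedBall_zero_iff, pi_norm_le_iff_of_nonneg hR0]
    intro i
    have h1 := hC i n hn0 u hu
    rw [abs_sub_comm] at h1
    have h2 := hCR i
    have h3 := hD' i
    have h4 := hC1 i
    rw [Real.norm_eq_abs]
    have h5 := abs_sub_abs_le_abs_sub
      (MvPolynomial.aeval (fun j => (u j : ℝ) / n) (topForm (f i)))
      (((MvPolynomial.eval u (f i) : ℤ) : ℝ) / (n : ℝ) ^ (f i).totalDegree)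
    linarith
  · rw [dist_pi_le_iff hδ.le]
    intro i
    rw [Real.dist_eq]
    refine (hC i n hn0 u hu).trans (le_trans ?_ hn.le)
    have := hCR i
    have : (0 : ℝ) ≤ D i := by positivity
    gcongr
    linarith

/-- Convergence in distribution of functions of uniform points of the boxes is convergence of the
averages over the boxes of bounded continuous functions. -/
lemma tendstoInDistribution_of_boxAverage {s : ℕ} {Ω : ℕ+ → Type*} [∀ n, MeasurableSpace (Ω n)]
    {P : (n : ℕ+) → Measure (Ω n)} [∀ n, IsProbabilityMeasure (P n)]
    {U : (n : ℕ+) → Ω n → Fin s → ℤ} (hU : ∀ n, HasLaw (U n) (uniformGrid s n) (P n))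
    {Ω' : Type*} [MeasurableSpace Ω'] {P' : Measure Ω'} [IsProbabilityMeasure P'] {Z : Ω' → ℝ}
    (hZ : AEMeasurable Z P') (X : ℕ → (Fin s → ℤ) → ℝ)
    (h : ∀ φ : BoundedContinuousFunction ℝ ℝ,
      Tendsto (fun n => boxAverage s n fun u => φ (X n u)) atTop (𝓝 (∫ ω, φ (Z ω) ∂P'))) :
    TendstoInDistribution (fun (n : ℕ+) ω => X n (U n ω)) atTop Z P P' := by
  have hX : ∀ n, Measurable (X n) := fun n => .of_discrete
  refine ⟨fun n => (hX n).comp_aemeasurable (hU n).aemeasurable, hZ, ?_⟩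
  refine ProbabilityMeasure.tendsto_iff_forall_integral_tendsto.2 fun φ => ?_
  have h1 : ∀ n : ℕ+, ∫ x, φ x ∂((P n).map fun ω => X n (U n ω)) =
      boxAverage s n fun u => φ (X n u) := by
    intro n
    have hXU : AEMeasurable (fun ω => X n (U n ω)) (P n) :=
      (hX n).comp_aemeasurable (hU n).aemeasurable
    rw [integral_map hXU
      φ.continuous.measurable.aestronglyMeasurable, ← integral_uniformGrid, ← (hU n).map_eq,
      integral_map (hU n).aemeasurable]
    exact (φ.continuous.measurable.comp (hX n)).aestronglyMeasurable
  change Tendsto (fun n : ℕ+ => ∫ x, φ x ∂((P n).map fun ω => X n (U n ω))) atTop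
    (𝓝 (∫ x, φ x ∂(P'.map Z)))
  rw [integral_map hZ φ.continuous.measurable.aestronglyMeasurable]
  simp_rw [h1]
  exact (h φ).comp tendsto_PNat_val_atTop_atTop

/-! ### Convergence in distribution -/

/-- The series of logarithms has only finitely many non-zero terms when only finitely many primes
divide two of the values, and its sum is minus the logarithm of the denominator. -/
lemma hasSum_log_limitDenominator {s m : ℕ} (f : Fin m → MvPolynomial (Fin s) ℤ)
    (x : Fin s → IntegerAdeles) (hfin : {p : Nat.Primes | AdeleDividesTwo f p x}.Finite) :
    HasSum (fun p : Nat.Primes => Real.log (p : ℕ) *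
      (((Finset.univ.sup fun i => (primeExponent p (MvPolynomial.aeval x (f i))).toNat : ℕ) : ℝ) -
        ∑ i, ((primeExponent p (MvPolynomial.aeval x (f i))).toNat : ℝ)))
      (Real.log (1 / (limitDenominator f x : ℝ))) := by
  have hterm : ∀ p : Nat.Primes, Real.log (p : ℕ) *
      (((Finset.univ.sup fun i => (primeExponent p (MvPolynomial.aeval x (f i))).toNat : ℕ) : ℝ) -
        ∑ i, ((primeExponent p (MvPolynomial.aeval x (f i))).toNat : ℝ)) =
      -(excess (adeleExponent f p x) * Real.log (p : ℕ)) := by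
    intro p
    rw [excess, Nat.cast_sub (sup_le_sum _), Nat.cast_sum]
    change _ * (((Finset.univ.sup (adeleExponent f p x) : ℕ) : ℝ) -
      ∑ i, (adeleExponent f p x i : ℝ)) = _
    ring
  have hS : ∀ p ∉ hfin.toFinset, ¬ AdeleDividesTwo f p x := fun p hp h => hp (hfin.mem_toFinset.2 h)
  have hlog : Real.log (1 / (limitDenominator f x : ℝ)) =
      ∑ p ∈ hfin.toFinset, -(excess (adeleExponent f p x) * Real.log (p : ℕ)) := by
    rw [limitDenominator_eq_prod hS, one_div, Real.log_inv, Nat.cast_prod, Real.log_prod,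
      Finset.sum_neg_distrib]
    · simp only [Nat.cast_pow, Real.log_pow]
    · intro p _
      exact_mod_cast (pow_pos p.2.pos _).ne'
  simp_rw [hterm]
  rw [hlog]
  refine hasSum_sum_of_ne_finset_zero fun p hp => ?_
  rw [excess_adeleExponent_eq_zero (hS p hp), Nat.cast_zero, zero_mul, neg_zero]

theorem theorem3p2 {s m : ℕ} (hm : 2 ≤ m) (f : Fin m → MvPolynomial (Fin s) ℤ)
    (hf : ∀ i, f i ≠ 0)
    -- no two of the polynomials have a common factor of positive degree
    (hfactor : ∀ i j, i ≠ j → ∀ h : MvPolynomial (Fin s) ℤ, h ∣ f i → h ∣ f j →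
      h.totalDegree = 0)
    -- `U n` is uniformly distributed on `{1, …, n} ^ s`
    {Ω : ℕ+ → Type*} [∀ n, MeasurableSpace (Ω n)] (P : (n : ℕ+) → Measure (Ω n))
    [∀ n, IsProbabilityMeasure (P n)] (U : (n : ℕ+) → Ω n → Fin s → ℤ)
    (hU : ∀ n, HasLaw (U n) (uniformGrid s n) (P n))
    -- `V 1, …, V s` are independent Haar distributed integer adeles
    {Ω' : Type*} [MeasurableSpace Ω'] (P' : Measure Ω') [IsProbabilityMeasure P']
    (V : Fin s → Ω' → IntegerAdeles) (hV : ∀ j, HasLaw (V j) adelesHaar P')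
    (hVindep : iIndepFun V P') :
    ∃ L : Ω' → ℝ, Measurable L ∧ (∀ ω, ∃ k : ℕ+, L ω = 1 / (k : ℝ)) ∧
      (∀ᵐ ω ∂P',
        (∀ p i, primeExponent p (MvPolynomial.aeval (fun j => V j ω) (f i)) ≠ ⊤) ∧
        HasSum
          (fun p : Nat.Primes => Real.log (p : ℕ) *
            (((Finset.univ.sup fun i =>
                (primeExponent p (MvPolynomial.aeval (fun j => V j ω) (f i))).toNat : ℕ) : ℝ) -
              ∑ i, ((primeExponent p (MvPolynomial.aeval (fun j => V j ω) (f i))).toNat : ℝ)))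
          (Real.log (L ω))) ∧
      TendstoInDistribution (fun n ω => intNLCM (polyValues f (U n ω))) atTop L P P' ∧
      ∀ Uinf : Ω' → Fin s → ℝ,
        HasLaw Uinf (volume.restrict (Set.Icc 0 1)) P' → IndepFun L Uinf P' →
        TendstoInDistribution
          (fun n ω => (intLCM (polyValues f (U n ω)) : ℝ) /
            ((n : ℕ) : ℝ) ^ (∑ i, (f i).totalDegree))
          atTop
          (fun ω => L ω * ∏ i, |MvPolynomial.aeval (Uinf ω) (topForm (f i))|) P P' := by
  -- a measurable version whose values are unit fractions everywhere, not only almost surely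
  have hae := aemeasurable_inv_limitDenominator hV hVindep hf hfactor
  obtain ⟨L, hLm, hLr, hL⟩ := hae.exists_ae_eq_range_subset
    (t := {x | ∃ k : ℕ+, x = 1 / (k : ℝ)})
    (Eventually.of_forall fun ω => ⟨⟨_, limitDenominator_pos f fun j => V j ω⟩, rfl⟩)
    ⟨1, 1, by simp⟩
  have hL' : ∀ᵐ ω ∂P', L ω = 1 / (limitDenominator f (fun j => V j ω) : ℝ) := by
    filter_upwards [hL] with ω hω using hω.symm
  have hvol : volume.real (Set.Icc (0 : Fin s → ℝ) 1) = 1 := by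
    simp [measureReal_def, Real.volume_Icc_pi]
  refine ⟨L, hLm, fun ω => hLr ⟨ω, rfl⟩, ?_, ?_, fun Uinf hUinf hind => ?_⟩
  · filter_upwards [ae_aeval_coordinate_ne_zero hV hVindep hf,
      ae_finite_adeleDividesTwo hV hVindep hf hfactor, hL'] with ω hω hfin hLω
    exact ⟨fun p i => primeExponent_ne_top (hω p i), hLω ▸ hasSum_log_limitDenominator f _ hfin⟩
  · refine tendstoInDistribution_of_boxAverage hU hLm.aemeasurable
      (fun _ u => intNLCM (polyValues f u)) fun φ => ?_
    have h1 := tendsto_boxAverage_intNLCM hV hVindep hf hfactor hLm hL'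
      (ψ := fun l _ => φ l) (g := fun _ l _ => φ l) (B := ‖φ‖) (fun l => continuous_const)
      (by simpa [hvol] using φ.continuous.measurable) (fun l _ => φ.norm_coe_le_norm l)
      (fun _ l _ => φ.norm_coe_le_norm l)
      (fun l ε hε => Eventually.of_forall fun n u _ => by simpa using hε.le)
    simpa [hvol] using h1
  · set G : (Fin s → ℝ) → ℝ := fun x => ∏ i, |MvPolynomial.aeval x (topForm (f i))| with hG
    have hGc : Continuous G := continuous_finsetProd _ fun i _ =>
      (MvPolynomial.continuous_aeval_int _).abs
    have hZ : AEMeasurable (fun ω => L ω * G (Uinf ω)) P' :=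
      hLm.aemeasurable.mul (hGc.measurable.comp_aemeasurable hUinf.aemeasurable)
    refine tendstoInDistribution_of_boxAverage hU hZ
      (fun n u => (intLCM (polyValues f u) : ℝ) / (n : ℝ) ^ (∑ i, (f i).totalDegree)) fun φ => ?_
    have hjoint : Continuous fun z : ℝ × (Fin s → ℝ) => φ (z.1 * G z.2) :=
      φ.continuous.comp (continuous_fst.mul (hGc.comp continuous_snd))
    have h1 := tendsto_boxAverage_intNLCM hV hVindep hf hfactor hLm hL'
      (ψ := fun l x => φ (l * G x))
      (g := fun n l u => φ (l * ∏ i, |((MvPolynomial.eval u (f i) : ℤ) : ℝ) /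
        (n : ℝ) ^ (f i).totalDegree|)) (B := ‖φ‖)
      (fun l => φ.continuous.comp (continuous_const.mul hGc))
      (hjoint.stronglyMeasurable.integral_prod_right
        (ν := volume.restrict (Set.Icc (0 : Fin s → ℝ) 1))).measurable
      (fun l _ => φ.norm_coe_le_norm _) (fun _ l _ => φ.norm_coe_le_norm _)
      (fun l ε hε => eventually_abs_sub_topForm_le f
        (h := fun y => φ (l * ∏ i, |y i|))
        (φ.continuous.comp (continuous_const.mul
          (continuous_finsetProd _ fun i _ => (continuous_apply i).abs))) hε)
    -- Fubini, as the joint law of `L` and `Uinf` is the product of their laws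
    have h2 : ∫ ω, φ (L ω * G (Uinf ω)) ∂P' =
        ∫ ω, (∫ x in Set.Icc 0 1, φ (L ω * G x)) ∂P' := by
      have hpair : AEMeasurable (fun ω => (L ω, Uinf ω)) P' :=
        hLm.aemeasurable.prodMk hUinf.aemeasurable
      have hLP : IsProbabilityMeasure (P'.map L) :=
        Measure.isProbabilityMeasure_map hLm.aemeasurable
      have hvolP : IsFiniteMeasure (volume.restrict (Set.Icc (0 : Fin s → ℝ) 1)) :=
        ⟨by simp [Real.volume_Icc_pi]⟩
      rw [← integral_map (φ := fun ω => (L ω, Uinf ω))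
        (f := fun z : ℝ × (Fin s → ℝ) => φ (z.1 * G z.2)) hpair
        hjoint.measurable.aestronglyMeasurable,
        (indepFun_iff_map_prod_eq_prod_map_map hLm.aemeasurable hUinf.aemeasurable).1 hind,
        hUinf.map_eq, integral_prod, integral_map hLm.aemeasurable]
      · exact (hjoint.stronglyMeasurable.integral_prod_right
          (ν := volume.restrict (Set.Icc (0 : Fin s → ℝ) 1))).aestronglyMeasurable
      · exact (integrable_const ‖φ‖).mono' hjoint.measurable.aestronglyMeasurable
          (Eventually.of_forall fun z => φ.norm_coe_le_norm _)
    rw [h2]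
    refine h1.congr fun n => ?_
    congr 1
    funext u
    congr 1
    rw [intLCM_eq_intNLCM_mul, mul_div_assoc]
    simp_rw [abs_div, abs_pow, Nat.abs_cast]
    rw [Finset.prod_div_distrib, Finset.prod_pow_eq_pow_sum]
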